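/- Conventions. Let $\Lambda$ be an ordered (i.e. totally ordered) abelian group and $\mathrm{Aut}^+(\Lambda)$ the group of its order-preserving group automorphisms. A $\Lambda$-metric space $(X,d)$ is a non-empty set with $d:X\times X\to\Lambda$ satisfying the usual axioms of a metric; put $(x\cdot y)_v=\frac12\left(d(x,v)+d(y,v)-d(x,y)\right)$. A $\Lambda$-tree is a $\Lambda$-metric space that is geodesic (any $x,y$ are joined by the image of an isometric embedding of $[0,d(x,y)]_\Lambda$), with $(x\cdot y)_v\in\Lambda$ and $(x\cdot y)_v\ge\min\{(x\cdot z)_v,(y\cdot z)_v\}$ for all $v,x,y,z$. The segment $[x,y]$ is $\{z: d(x,z)+d(z,y)=d(x,y)\}$. An affine action of a group $G$ on a $\Lambda$-tree $X$ consists of a homomorphism $\alpha:G\to\mathrm{Aut}^+(\Lambda)$ and an action of $G$ on $X$ with $d(gx,gy)=\alpha_g(d(x,y))$. It is * free if no $g\ne1$ fixes a point and there are no inversions (an inversion is a $g$ with no fixed point such that $g^2$ has a fixed point); * rigid if no $g\in G$ maps a segment properly into itself; * regular if there is a basepoint $x$ such that $L(g)=d(x,gx)$ satisfies: for all $g,h\in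 G$ there are $u,g',h'\in G$ with $g=ug'$, $h=uh'$, $L(g)=L(u)+\alpha_uL(g')$, $L(h)=L(u)+\alpha_uL(h')$ and $L(u)=\frac12\left(L(g)+L(h)-\alpha_gL(g^{-1}h)\right)$. A group is $\mathrm{ATF}(\Lambda)$ if it admits a free affine action on some $\Lambda$-tree, and $\mathrm{ATF}$ if it is $\mathrm{ATF}(\Lambda)$ for some ordered abelian group $\Lambda$. Theorem. Let $G_i$ $(i\in I)$ be a family of groups. (1) Let $\Lambda$ be an ordered abelian group and suppose that each $G_i$ is given an affine action on a $\Lambda$-tree $X_i$, with associated homomorphism $\alpha^{(i)}:G_i\to\mathrm{Aut}^+(\Lambda)$. Then the free product $G=\ast_{i\in I}G_i$ has an affine action on a $\Lambda$-tree $Y$ which extends the given actions: its homomorphism $\beta:G\to\mathrm{Aut}^+(\Lambda)$ restricts to $\alpha^{(i)}$ on each $G_i$, and for each $i$ there is a $G_i$-equivariant isometric embedding $X_i\to Y$. Moreover, if the given actions of the $G_i$ are all free, or all free and rigid, or all regular, then so, respectively, is the action of $G$ on $Y$. (2) If every $G_i$ is an $\mathrm{ATF}(\mathbb R)$ group, then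 so is $\ast_{i\in I}G_i$. (3) If every $G_i$ is an $\mathrm{ATF}$ group (the ordered abelian group being allowed to vary with $i$), then so is $\ast_{i\in I}G_i$. -/

import Mathlib

universe uI uG uL uX

namespace LambdaTree

/-- `Aut⁺(Λ)`: the order-preserving group automorphisms of an ordered abelian group `Λ`. -/
abbrev OrdAut (Λ : Type*) [AddCommGroup Λ] [LinearOrder Λ] : Type _ := Λ ≃+o Λ

/-- `Aut⁺(Λ)` is a group under composition. -/
instance instGroupOrdAut (Λ : Type*) [AddCommGroup Λ] [LinearOrder Λ] : Group (OrdAut Λ) where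
  mul a b := OrderAddMonoidIso.trans b a
  one := OrderAddMonoidIso.refl Λ
  inv a := OrderAddMonoidIso.symm a
  mul_assoc _ _ _ := rfl
  one_mul _ := rfl
  mul_one _ := rfl
  inv_mul_cancel a := by
    ext x
    exact a.symm_apply_apply x

section

variable {Λ : Type*} [AddCommGroup Λ] [LinearOrder Λ]

theorem OrdAut.one_apply (x : Λ) : (1 : OrdAut Λ) x = x := rfl

theorem OrdAut.mul_apply (a b : OrdAut Λ) (x : Λ) : (a * b) x = a (b x) := rfl

end

/-- Twice the Gromov product `(x · y)_v`. -/
def gromovTwice {Λ X : Type*} [AddCommGroup Λ] (d : X → X → Λ) (v x y : X) : Λ :=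
  d x v + d y v - d x y

/-- `(X, d)` is a (non-empty) `Λ`-metric space: `d` takes values in the ordered abelian group `Λ`
and satisfies the axioms of a metric. -/
structure IsLambdaMetric {Λ X : Type*} [AddCommGroup Λ] [LinearOrder Λ]
    (d : X → X → Λ) : Prop where
  nonempty : Nonempty X
  nonneg : ∀ x y, 0 ≤ d x y
  eq_zero_iff : ∀ x y, d x y = 0 ↔ x = y
  symm : ∀ x y, d x y = d y x
  triangle : ∀ x y z, d x z ≤ d x y + d y z

/-- `(X, d)` is a `Λ`-tree: it is geodesic, all Gromov products `(x · y)_v` lie in `Λ`, and it is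
`0`-hyperbolic. -/
structure IsLambdaTree {Λ X : Type*} [AddCommGroup Λ] [LinearOrder Λ]
    (d : X → X → Λ) : Prop extends IsLambdaMetric d where
  /-- Any two points are joined by the image of an isometric embedding of `[0, d(x,y)]`. -/
  geodesic : ∀ x y, ∃ σ : Λ → X, σ 0 = x ∧ σ (d x y) = y ∧
    ∀ s ∈ Set.Icc 0 (d x y), ∀ t ∈ Set.Icc 0 (d x y), d (σ s) (σ t) = |s - t|
  gromov_mem : ∀ v x y, ∃ c : Λ, 2 • c = gromovTwice d v x y
  hyperbolic : ∀ v x y z, min (gromovTwice d v x z) (gromovTwice d v y z) ≤ gromovTwice d v x y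

/-- The segment `[x, y]` of a `Λ`-tree. -/
def segment {Λ X : Type*} [AddCommGroup Λ] (d : X → X → Λ) (x y : X) : Set X :=
  {z | d x z + d z y = d x y}

/-- The given action of `G` on `(X, d)` is `α`-affine: each `g` scales distances by `α g`.
(Each `g` acts bijectively since this is a group action.) -/
def IsAffineAction {G Λ X : Type*} [Group G] [AddCommGroup Λ] [LinearOrder Λ] [MulAction G X]
    (d : X → X → Λ) (α : G →* OrdAut Λ) : Prop :=
  ∀ (g : G) (x y : X), d (g • x) (g • y) = α g (d x y)

/-- `g` is an inversion: `g` fixes no point but `g²` does. -/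
def IsInversion {G : Type*} (X : Type*) [Group G] [MulAction G X] (g : G) : Prop :=
  (∀ x : X, g • x ≠ x) ∧ ∃ x : X, (g ^ 2) • x = x

/-- The action is free (non-trivial elements fix no point) and without inversions. -/
def IsFreeAction (G X : Type*) [Group G] [MulAction G X] : Prop :=
  (∀ g : G, g ≠ 1 → ∀ x : X, g • x ≠ x) ∧ ∀ g : G, ¬ IsInversion X g

/-- The action is rigid: no group element maps a segment properly into itself. -/
def IsRigidAction {Λ X : Type*} (G : Type*) [Group G] [AddCommGroup Λ] [MulAction G X]
    (d : X → X → Λ) : Prop :=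
  ∀ (g : G) (x y : X), ¬ ((fun z => g • z) '' segment d x y ⊂ segment d x y)

/-- A function `L : G → Λ` (with respect to `α : G → Aut⁺(Λ)`) is regular: for all `g, h` there are
`u, g', h'` with `g = u g'`, `h = u h'`, `L(g) = L(u) + α_u L(g')`, `L(h) = L(u) + α_u L(h')` and
`L(u) = c(g,h) = (L(g) + L(h) - α_g L(g⁻¹h)) / 2`. -/
def IsRegularLength {G Λ : Type*} [Group G] [AddCommGroup Λ] [LinearOrder Λ]
    (α : G →* OrdAut Λ) (L : G → Λ) : Prop :=
  ∀ g h : G, ∃ u g' h' : G, g = u * g' ∧ h = u * h' ∧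
    2 • L u = L g + L h - α g (L (g⁻¹ * h)) ∧
    L g = L u + α u (L g') ∧ L h = L u + α u (L h')

/-- The action is regular: for some base point `x`, the based length function
`L_x(g) = d(x, g x)` is regular. -/
def IsRegularAction {G Λ X : Type*} [Group G] [AddCommGroup Λ] [LinearOrder Λ] [MulAction G X]
    (d : X → X → Λ) (α : G →* OrdAut Λ) : Prop :=
  ∃ x : X, IsRegularLength α (fun g => d x (g • x))

/-- `G` is an `ATF(Λ)` group: it admits a free affine action, without inversions, on some
`Λ`-tree. -/
def IsATFOver (Λ : Type uL) [AddCommGroup Λ] [LinearOrder Λ] (G : Type uG) [Group G] : Prop :=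
  ∃ (X : Type uX) (_ : MulAction G X) (d : X → X → Λ) (α : G →* OrdAut Λ),
    IsLambdaTree d ∧ IsAffineAction d α ∧ IsFreeAction G X

/-- `G` is an `ATF` group: it is `ATF(Λ)` for some ordered abelian group `Λ`. -/
def IsATF (G : Type uG) [Group G] : Prop :=
  ∃ (Λ : Type uL) (_ : AddCommGroup Λ) (_ : LinearOrder Λ) (_ : IsOrderedAddMonoid Λ),
    IsATFOver.{uG, uL, uX} Λ G

end LambdaTree

-- The tree `Y` is a tree of trees. The `X i` are glued at base points, and behind every translate
-- of the base point further copies are hung, rescaled by the automorphism belonging to the group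
-- element that leads there. A point `g • x` is coded by a reduced word whose letters are the
-- syllables of `g`, with `x` absorbed into the last letter if it lies in the tree of the same
-- factor. To measure two words, cancel the common prefix, compare the first differing letters in
-- the wedge of the `X i`, add the rescaled lengths of the tails, and apply the twist of the prefix.
-- This formula is compatible with the action (`PointedFamily.wordDist_smul`), satisfies the
-- ultrametric inequality for Gromov products (`LetterSystem.listDist_ultra`) and admits geodesics
-- (`PointedFamily.Point.pseudoGeodesic`). Different words can be at distance zero, so the work is
-- done with pseudometrics, and `ZeroHyperbolic.exists_tree` passes to the quotient.
--
-- Freeness holds because a nontrivial syllable moves the base point of its tree, which makes the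
-- relevant word lengths positive (`eq_one_of_dist_smul_eq_zero`); inversions are excluded since the
-- free product has no element of order two. For rigidity, let `g` map a segment into itself. Then
-- `g` or its square shifts the segment, so all powers of that element keep an end point on it, and
-- their word lengths stay bounded. This rules out conjugates of cyclically reduced words of length
-- at least two, and an element conjugate into a factor must shift a segment of that factor's own
-- tree (`eq_one_of_shiftsSegment`). Regularity passes to the free product by comparing syllables
-- (`isRegularLength`).
--
-- Closure for `ℝ` is the case of a common `Λ`. When the ordered groups vary, they are embedded in
-- one lexicographic product over a well-ordered index set, and each tree is filled in by base
-- change (`IsATFOver.baseChange`). New points differ from old ones only infinitesimally, relative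
-- to the old distances, so no new fixed points arise.

universe uP

set_option linter.unusedSectionVars false

namespace LambdaTree

section OrdAut

variable {Λ : Type uL} [AddCommGroup Λ] [LinearOrder Λ]

theorem OrdAut.map_pos (f : OrdAut Λ) {a : Λ} (h : 0 < a) : 0 < f a := by
  rwa [← map_zero f, map_lt_map_iff]

theorem OrdAut.map_nonneg (f : OrdAut Λ) {a : Λ} (h : 0 ≤ a) : 0 ≤ f a := by
  rwa [← map_zero f, map_le_map_iff]

theorem OrdAut.map_eq_zero (f : OrdAut Λ) {a : Λ} : f a = 0 ↔ a = 0 :=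
  map_eq_zero_iff f f.injective

theorem OrdAut.inv_apply_self (f : OrdAut Λ) (a : Λ) : f⁻¹ (f a) = a := by
  rw [← OrdAut.mul_apply, inv_mul_cancel, OrdAut.one_apply]

theorem OrdAut.apply_inv_self (f : OrdAut Λ) (a : Λ) : f (f⁻¹ a) = a := by
  rw [← OrdAut.mul_apply, mul_inv_cancel, OrdAut.one_apply]

end OrdAut

/-! ### Zero-hyperbolic pseudometrics, their geodesics, and the quotient tree. -/

section ZeroHyperbolic

variable {Λ : Type uL} [AddCommGroup Λ] [LinearOrder Λ] [IsOrderedAddMonoid Λ]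

/-- A symmetric function with zero diagonal satisfying the four point condition: a `0`-hyperbolic
pseudometric. -/
structure ZeroHyperbolic {P : Type*} (D : P → P → Λ) : Prop where
  self : ∀ p, D p p = 0
  symm : ∀ p q, D p q = D q p
  four_point : ∀ p q r s, D p q + D r s ≤ max (D p r + D q s) (D p s + D q r)

/-- `p` and `q` are joined by a geodesic, up to points at distance zero. -/
def PseudoGeodesic {P : Type*} (D : P → P → Λ) (p q : P) : Prop :=
  ∃ σ : Λ → P, D (σ 0) p = 0 ∧ D (σ (D p q)) q = 0 ∧
    ∀ s ∈ Set.Icc 0 (D p q), ∀ t ∈ Set.Icc 0 (D p q), D (σ s) (σ t) = |s - t|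

variable {P : Type uP} {D : P → P → Λ}

namespace ZeroHyperbolic

variable (h : ZeroHyperbolic D)
include h

theorem nonneg (p q : P) : 0 ≤ D p q := by
  have h1 := h.four_point p p q q
  rw [h.self, h.self, max_self] at h1
  grind

theorem triangle (p q r : P) : D p r ≤ D p q + D q r := by
  have h1 := h.four_point p r q q
  have h2 := h.symm q r
  rw [h.self] at h1
  grind

theorem congr_left {p q : P} (hpq : D p q = 0) (r : P) : D p r = D q r := by
  have h1 := h.triangle p q r
  have h2 := h.triangle q p r
  have h3 := h.symm p q
  grind

theorem congr_right {p q : P} (hpq : D p q = 0) (r : P) : D r p = D r q := by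
  rw [h.symm r p, h.symm r q, h.congr_left hpq]

theorem min_gromovTwice_le (v x y z : P) :
    min (gromovTwice D v x z) (gromovTwice D v y z) ≤ gromovTwice D v x y := by
  have h1 := h.four_point x y z v
  have h2 := h.symm y z
  unfold gromovTwice
  grind

/-- If `q` lies on `[x, y]` and `v` is any point, then `q` lies on `[v, x]` or on `[v, y]`. -/
theorem between_of_between {x q y : P} (hq : D x q + D q y = D x y) (v : P) :
    D v q + D q x = D v x ∨ D v q + D q y = D v y := by
  have h1 := h.four_point x y v q
  have h2 := h.triangle v q x
  have h3 := h.triangle v q y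
  have := h.symm x v
  have := h.symm y v
  have := h.symm x q
  have := h.symm y q
  grind

/-- The distance between two points of a segment is the difference of their distances to an
end point. -/
theorem dist_eq_sub {x p q y : P} (hp : D x p + D p y = D x y) (hq : D x q + D q y = D x y)
    (hpq : D x p ≤ D x q) : D p q = D x q - D x p := by
  have h1 := h.four_point p q x y
  have h2 := h.triangle x p q
  have := h.symm x p
  have := h.symm x q
  grind

end ZeroHyperbolic

theorem PseudoGeodesic.symm (h : ZeroHyperbolic D) {p q : P} (hg : PseudoGeodesic D p q) :
    PseudoGeodesic D q p := by
  obtain ⟨σ, h0, h1, h2⟩ := hg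
  refine ⟨fun s => σ (D p q - s), by simpa using h1, ?_, ?_⟩
  · simpa [h.symm q p] using h0
  · rw [h.symm q p]
    intro s hs t ht
    have := h2 (D p q - s) (by simp only [Set.mem_Icc] at *; grind)
      (D p q - t) (by simp only [Set.mem_Icc] at *; grind)
    rw [this, abs_sub_comm]
    congr 1
    abel

/-- A tail of a pseudo-geodesic is a pseudo-geodesic. -/
theorem PseudoGeodesic.tail (h : ZeroHyperbolic D) {x p q : P} (hg : PseudoGeodesic D x q)
    (hp : D x p + D p q = D x q) : PseudoGeodesic D p q := by
  obtain ⟨σ, h0, h1, h2⟩ := hg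
  have hn1 := h.nonneg x p
  have hn2 := h.nonneg p q
  have hn3 := h.nonneg x q
  have hr1 : D x (σ (D x p)) = D x p := by
    rw [← h.congr_left h0, h2 0 (by simp [hn3]) _ (by simp only [Set.mem_Icc]; grind)]
    rw [zero_sub, abs_neg, abs_of_nonneg hn1]
  have hr2 : D (σ (D x p)) q = D p q := by
    rw [← h.congr_right h1, h2 _ (by simp only [Set.mem_Icc]; grind) _ (by simp [hn3])]
    grind
  -- Two points of a segment at the same distance from one end point are at distance zero.
  have hr : D (σ (D x p)) p = 0 := by
    have h3 := h.dist_eq_sub (x := x) (y := q) (p := σ (D x p)) (q := p) (by rw [hr1, hr2, hp]) hp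
      hr1.le
    rw [h3, hr1, sub_self]
  refine ⟨fun s => σ (D x p + s), by simpa using hr, by simpa [hp] using h1, ?_⟩
  intro s hs t ht
  rw [h2 _ (by simp only [Set.mem_Icc] at *; grind) _ (by simp only [Set.mem_Icc] at *; grind)]
  congr 1
  abel

/-- Concatenation of pseudo-geodesics whose lengths add up. -/
theorem PseudoGeodesic.trans (h : ZeroHyperbolic D) {x y z : P} (h1 : PseudoGeodesic D x y)
    (h2 : PseudoGeodesic D y z) (ha : D x z = D x y + D y z) : PseudoGeodesic D x z := by
  obtain ⟨σ, a0, a1, a2⟩ := h1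
  obtain ⟨τ, b0, b1, b2⟩ := h2
  have n1 := h.nonneg x y
  have n2 := h.nonneg y z
  have sx : ∀ s ∈ Set.Icc 0 (D x y), D x (σ s) = s ∧ D (σ s) y = D x y - s := by
    intro s hs
    rw [← h.congr_left a0, ← h.congr_right a1, a2 _ (by simp [n1]) _ hs,
      a2 _ hs _ (by simp [n1])]
    simp only [Set.mem_Icc] at hs
    grind
  have tz : ∀ s ∈ Set.Icc 0 (D y z), D y (τ s) = s ∧ D (τ s) z = D y z - s := by
    intro s hs
    rw [← h.congr_left b0, ← h.congr_right b1, b2 _ (by simp [n2]) _ hs,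
      b2 _ hs _ (by simp [n2])]
    simp only [Set.mem_Icc] at hs
    grind
  have key : ∀ s ∈ Set.Icc 0 (D x y), ∀ t ∈ Set.Icc 0 (D y z),
      D (σ s) (τ t) = (D x y - s) + t := by
    intro s hs t ht
    have e1 := h.triangle (σ s) y (τ t)
    have e2 := h.triangle x (σ s) z
    have e3 := h.triangle (σ s) (τ t) z
    have := sx s hs
    have := tz t ht
    grind
  refine ⟨fun s => if s ≤ D x y then σ s else τ (s - D x y), ?_, ?_, ?_⟩
  · simp only [n1, if_true, a0]
  -- The end point falls into the first branch exactly when the second piece has length zero.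
  · by_cases hz : D x z ≤ D x y
    · have hz' : D y z = 0 := by grind
      have e : D x z = D x y := by grind
      simp only [hz, if_true]
      rw [e, h.congr_left a1, hz']
    · simp only [hz, if_false]
      have e : D x z - D x y = D y z := by grind
      rw [e, b1]
  · intro s hs t ht
    simp only [Set.mem_Icc] at hs ht
    by_cases c1 : s ≤ D x y <;> by_cases c2 : t ≤ D x y <;> simp only [c1, c2, if_true, if_false]
    · exact a2 s ⟨hs.1, c1⟩ t ⟨ht.1, c2⟩
    · rw [key s ⟨hs.1, c1⟩ _ ⟨by grind, by grind⟩]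
      grind
    · rw [h.symm, key t ⟨ht.1, c2⟩ _ ⟨by grind, by grind⟩]
      grind
    · rw [b2 _ ⟨by grind, by grind⟩ _ ⟨by grind, by grind⟩]
      grind

theorem PseudoGeodesic.congr_left (h : ZeroHyperbolic D) {p p' q : P}
    (hg : PseudoGeodesic D p q) (hp : D p p' = 0) : PseudoGeodesic D p' q := by
  obtain ⟨σ, h0, h1, h2⟩ := hg
  have e := h.congr_left hp q
  exact ⟨σ, by rw [← h.congr_right hp, h0], by rw [← e, h1], by rw [← e]; exact h2⟩

/-- Pseudo-geodesics are carried to pseudo-geodesics by bijections scaling the distance. -/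
theorem PseudoGeodesic.map {f : P → P} {α : OrdAut Λ} (hf : ∀ p q, D (f p) (f q) = α (D p q))
    {p q : P} (hg : PseudoGeodesic D p q) : PseudoGeodesic D (f p) (f q) := by
  obtain ⟨σ, h0, h1, h2⟩ := hg
  have hI : ∀ s, s ∈ Set.Icc 0 (α (D p q)) → α⁻¹ s ∈ Set.Icc 0 (D p q) := by
    intro s hs
    refine ⟨OrdAut.map_nonneg _ hs.1, ?_⟩
    rw [← map_le_map_iff α, OrdAut.apply_inv_self]
    exact hs.2
  refine ⟨fun s => f (σ (α⁻¹ s)), ?_, ?_, ?_⟩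
  · rw [hf, map_zero, h0, map_zero]
  · rw [hf, hf, OrdAut.inv_apply_self, h1, map_zero]
  · rw [hf]
    intro s hs t ht
    rw [hf, h2 _ (hI s hs) _ (hI t ht), map_abs, map_sub, OrdAut.apply_inv_self,
      OrdAut.apply_inv_self]

theorem IsLambdaTree.zeroHyperbolic (hD : IsLambdaTree D) : ZeroHyperbolic D where
  self p := (hD.eq_zero_iff p p).2 rfl
  symm := hD.symm
  four_point p q r s := by
    have h1 := hD.hyperbolic s p q r
    have := hD.symm q r
    unfold gromovTwice at h1
    grind

theorem IsLambdaTree.pseudoGeodesic (hD : IsLambdaTree D) (p q : P) : PseudoGeodesic D p q := by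
  obtain ⟨σ, h0, h1, h2⟩ := hD.geodesic p q
  exact ⟨σ, (hD.eq_zero_iff _ _).2 h0, (hD.eq_zero_iff _ _).2 h1, h2⟩

/-- The points at distance zero of a `0`-hyperbolic pseudometric. -/
def ZeroHyperbolic.setoid (h : ZeroHyperbolic D) : Setoid P where
  r p q := D p q = 0
  iseqv := ⟨h.self, fun {p q} hp => by rw [h.symm, hp],
    fun {p q r} hp hq => by rw [h.congr_left hp, hq]⟩

/-- A geodesic `0`-hyperbolic pseudometric space with an affine action has a `Λ`-tree as a
quotient. -/
theorem ZeroHyperbolic.exists_tree {H : Type*} [Group H] [MulAction H P] {α : H →* OrdAut Λ}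
    (h : ZeroHyperbolic D) [hP : Nonempty P]
    (hmem : ∀ v x y, ∃ c : Λ, 2 • c = gromovTwice D v x y)
    (hgeo : ∀ p q, PseudoGeodesic D p q) (haff : IsAffineAction D α) :
    ∃ (Y : Type (max uP uL)) (_ : MulAction H Y) (E : Y → Y → Λ) (π : P → Y),
      IsLambdaTree E ∧ IsAffineAction E α ∧ Function.Surjective π ∧
      (∀ p q, E (π p) (π q) = D p q) ∧ ∀ (g : H) p, π (g • p) = g • π p := by
  let S : Setoid P := h.setoid
  let E₀ : Quotient S → Quotient S → Λ := Quotient.lift₂ D (fun a b c d h1 h2 => by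
    rw [h.congr_left h1, h.congr_right h2])
  let π : P → ULift.{uL} (Quotient S) := fun p => ⟨Quotient.mk S p⟩
  have hπ : Function.Surjective π := by
    rintro ⟨y⟩
    obtain ⟨p, rfl⟩ := Quotient.exists_rep y
    exact ⟨p, rfl⟩
  have hπe : ∀ {p q}, π p = π q ↔ D p q = 0 := by
    intro p q
    rw [ULift.ext_iff]
    exact Quotient.eq (r := S)
  let sm : H → ULift.{uL} (Quotient S) → ULift.{uL} (Quotient S) := fun g y =>
    ⟨Quotient.map (sa := S) (sb := S) (fun p => g • p) (fun p q hpq => by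
      change D (g • p) (g • q) = 0
      rw [haff, show D p q = 0 from hpq, map_zero]) y.down⟩
  have hsm : ∀ g p, sm g (π p) = π (g • p) := fun g p => rfl
  let act : MulAction H (ULift.{uL} (Quotient S)) :=
    { smul := sm
      one_smul := by
        intro y
        obtain ⟨p, rfl⟩ := hπ y
        change sm 1 (π p) = π p
        rw [hsm, one_smul]
      mul_smul := by
        intro a b y
        obtain ⟨p, rfl⟩ := hπ y
        change sm (a * b) (π p) = sm a (sm b (π p))
        rw [hsm, hsm, hsm, mul_smul] }
  let E : ULift.{uL} (Quotient S) → ULift.{uL} (Quotient S) → Λ := fun x y => E₀ x.down y.down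
  have hE : ∀ p q, E (π p) (π q) = D p q := fun p q => rfl
  refine ⟨ULift.{uL} (Quotient S), act, E, π, ?_, ?_, hπ, hE, fun g p => rfl⟩
  · refine { nonempty := hP.map π, nonneg := ?_, eq_zero_iff := ?_, symm := ?_, triangle := ?_,
             geodesic := ?_, gromov_mem := ?_, hyperbolic := ?_ }
    · rintro x y
      obtain ⟨p, rfl⟩ := hπ x
      obtain ⟨q, rfl⟩ := hπ y
      exact h.nonneg p q
    · rintro x y
      obtain ⟨p, rfl⟩ := hπ x
      obtain ⟨q, rfl⟩ := hπ y
      rw [hE, hπe]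
    · rintro x y
      obtain ⟨p, rfl⟩ := hπ x
      obtain ⟨q, rfl⟩ := hπ y
      exact h.symm p q
    · rintro x y z
      obtain ⟨p, rfl⟩ := hπ x
      obtain ⟨q, rfl⟩ := hπ y
      obtain ⟨r, rfl⟩ := hπ z
      exact h.triangle p q r
    · rintro x y
      obtain ⟨p, rfl⟩ := hπ x
      obtain ⟨q, rfl⟩ := hπ y
      obtain ⟨σ, h0, h1, h2⟩ := hgeo p q
      exact ⟨fun s => π (σ s), hπe.2 h0, hπe.2 h1, h2⟩
    · rintro x y z
      obtain ⟨p, rfl⟩ := hπ x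
      obtain ⟨q, rfl⟩ := hπ y
      obtain ⟨r, rfl⟩ := hπ z
      exact hmem p q r
    · rintro x y z w
      obtain ⟨p, rfl⟩ := hπ x
      obtain ⟨q, rfl⟩ := hπ y
      obtain ⟨r, rfl⟩ := hπ z
      obtain ⟨s, rfl⟩ := hπ w
      exact h.min_gromovTwice_le p q r s
  · intro g x y
    obtain ⟨p, rfl⟩ := hπ x
    obtain ⟨q, rfl⟩ := hπ y
    exact haff g p q

end ZeroHyperbolic

end LambdaTree

/-! ### Base change of a tree along an embedding of ordered groups. -/

namespace LambdaTree

section BaseChange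

variable {Λ₀ : Type*} [AddCommGroup Λ₀] [LinearOrder Λ₀] [IsOrderedAddMonoid Λ₀]
  {Λ : Type uL} [AddCommGroup Λ] [LinearOrder Λ] [IsOrderedAddMonoid Λ]
  {X : Type uX}

/-- The point at distance `pos` from `src` on a segment from `src` to `tgt` of length
`ι (d src tgt)`. -/
@[ext]
structure FillPoint (ι : Λ₀ →+ Λ) (d : X → X → Λ₀) where
  src : X
  tgt : X
  pos : Λ
  nonneg : 0 ≤ pos
  le : pos ≤ ι (d src tgt)

namespace FillPoint

variable {ι : Λ₀ →+ Λ} {d : X → X → Λ₀}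

/-- The end points of the segment containing `p`: `src` for `false`, `tgt` for `true`. -/
def endpoint (p : FillPoint ι d) (b : Bool) : X := cond b p.tgt p.src

/-- The distance from `p` to the end points of its segment. -/
def offset (p : FillPoint ι d) (b : Bool) : Λ := cond b (ι (d p.src p.tgt) - p.pos) p.pos

/-- A lower bound for the distance from `p` to `q`, attained for suitable end points. -/
def lower (p q : FillPoint ι d) (b c : Bool) : Λ :=
  ι (d (p.endpoint b) (q.endpoint c)) - p.offset b - q.offset c

/-- The distance on the `Λ`-tree spanned by `X`. -/
def dist (p q : FillPoint ι d) : Λ :=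
  max (max (p.lower q false false) (p.lower q false true))
    (max (p.lower q true false) (p.lower q true true))

theorem lower_le_dist (p q : FillPoint ι d) (b c : Bool) : p.lower q b c ≤ p.dist q := by
  cases b <;> cases c <;> simp [dist]

theorem exists_dist_eq (p q : FillPoint ι d) : ∃ b c, p.dist q = p.lower q b c := by
  unfold dist
  rcases max_choice (max (p.lower q false false) (p.lower q false true))
    (max (p.lower q true false) (p.lower q true true)) with h | h <;> rw [h]
  · rcases max_choice (p.lower q false false) (p.lower q false true) with h | h <;> rw [h]
    exacts [⟨_, _, rfl⟩, ⟨_, _, rfl⟩]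
  · rcases max_choice (p.lower q true false) (p.lower q true true) with h | h <;> rw [h]
    exacts [⟨_, _, rfl⟩, ⟨_, _, rfl⟩]

/-- The points of `X` as points of the spanned tree. -/
def base (ι : Λ₀ →+ Λ) (h : ZeroHyperbolic d) (x : X) : FillPoint ι d :=
  ⟨x, x, 0, le_rfl, by rw [h.self, map_zero]⟩

section

variable (hι : Monotone ι) (h : ZeroHyperbolic d)
include hι h

/-- In a tree each number `lower` is at most the true distance, and some choice of end points
attains it by prolonging the path from `p` to `q` in both directions. With the maximum as
definition, the four point condition follows from that of `d` at the end points attaining the two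
distances on the left: on the right, any choice of end points gives a lower bound. -/
theorem zeroHyperbolic : ZeroHyperbolic (dist : FillPoint ι d → FillPoint ι d → Λ) where
  self p := by
    have := p.nonneg
    have := p.le
    have := h.symm p.src p.tgt
    simp only [dist, lower, endpoint, offset, cond_true, cond_false, h.self, map_zero, this]
    grind
  symm p q := by
    have h1 : ∀ b c, p.lower q b c = q.lower p c b := by
      intro b c
      unfold lower
      rw [h.symm]
      abel
    apply le_antisymm
    · obtain ⟨b, c, hb⟩ := p.exists_dist_eq q
      rw [hb, h1]
      exact lower_le_dist _ _ _ _
    · obtain ⟨b, c, hb⟩ := q.exists_dist_eq p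
      rw [hb, ← h1]
      exact lower_le_dist _ _ _ _
  four_point p q r s := by
    obtain ⟨b, c, hb⟩ := p.exists_dist_eq q
    obtain ⟨e, f, he⟩ := r.exists_dist_eq s
    have h1 := h.four_point (p.endpoint b) (q.endpoint c) (r.endpoint e) (s.endpoint f)
    have h2 := hι h1
    rw [map_add, hι.map_max, map_add, map_add] at h2
    have a1 := p.lower_le_dist r b e
    have a2 := q.lower_le_dist s c f
    have a3 := p.lower_le_dist s b f
    have a4 := q.lower_le_dist r c e
    rw [hb, he]
    unfold lower at *
    grind

theorem dist_base_base (x y : X) : (base ι h x).dist (base ι h y) = ι (d x y) := by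
  simp [dist, lower, endpoint, offset, base, h.self]

theorem dist_base_src (p : FillPoint ι d) : (base ι h p.src).dist p = p.pos := by
  have := p.nonneg
  simp only [dist, lower, endpoint, offset, base, cond_true, cond_false, h.self, map_zero]
  grind

theorem dist_base_tgt (p : FillPoint ι d) : (base ι h p.tgt).dist p = ι (d p.src p.tgt) - p.pos := by
  have := p.le
  have := h.symm p.src p.tgt
  simp only [dist, lower, endpoint, offset, base, cond_true, cond_false, h.self, map_zero]
  grind

theorem dist_base_endpoint (p : FillPoint ι d) (b : Bool) :
    (base ι h (p.endpoint b)).dist p = p.offset b := by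
  cases b
  · exact dist_base_src hι h p
  · exact dist_base_tgt hι h p

/-- Replacing an end point by the other one changes `lower` by twice an element of `Λ`. So modulo
`2Λ` the distance is given by the sources and the positions alone, whichever end points attain the
maximum, and the Gromov products of the sources finish the argument. -/
theorem gromovTwice_mem (hmem : ∀ v x y, ∃ c : Λ₀, 2 • c = gromovTwice d v x y)
    (v p q : FillPoint ι d) : ∃ c : Λ, 2 • c = gromovTwice dist v p q := by
  have key : ∀ p q : FillPoint ι d, ∃ c : Λ,
      p.dist q = ι (d p.src q.src) + p.pos + q.pos + 2 • c := by
    intro p q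
    obtain ⟨b, c, hb⟩ := p.exists_dist_eq q
    rw [hb]
    cases b <;> cases c
    · refine ⟨- p.pos - q.pos, ?_⟩
      simp only [lower, endpoint, offset, cond_false]
      abel
    · obtain ⟨e, he⟩ := hmem q.src p.src q.tgt
      have := congrArg ι he
      refine ⟨- ι e - p.pos, ?_⟩
      have := h.symm q.tgt q.src
      simp only [lower, endpoint, offset, cond_true, cond_false, gromovTwice, map_sub, map_add,
        map_nsmul] at *
      grind
    · obtain ⟨e, he⟩ := hmem p.src q.src p.tgt
      have := congrArg ι he
      refine ⟨- ι e - q.pos, ?_⟩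
      have := h.symm p.tgt p.src
      have := h.symm p.tgt q.src
      have := h.symm p.src q.src
      simp only [lower, endpoint, offset, cond_true, cond_false, gromovTwice, map_sub, map_add,
        map_nsmul] at *
      grind
    · obtain ⟨e, he⟩ := hmem p.src q.src p.tgt
      obtain ⟨f, hf⟩ := hmem q.src p.tgt q.tgt
      have := congrArg ι he
      have := congrArg ι hf
      refine ⟨- ι e - ι f, ?_⟩
      have := h.symm p.tgt p.src
      have := h.symm q.tgt q.src
      have := h.symm p.tgt q.src
      have := h.symm p.src q.src
      simp only [lower, endpoint, offset, cond_true, gromovTwice, map_sub, map_add,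
        map_nsmul] at *
      grind
  obtain ⟨c1, h1⟩ := key p v
  obtain ⟨c2, h2⟩ := key q v
  obtain ⟨c3, h3⟩ := key p q
  obtain ⟨e, he⟩ := hmem v.src p.src q.src
  have := congrArg ι he
  refine ⟨ι e + v.pos + c1 + c2 - c3, ?_⟩
  simp only [gromovTwice, map_sub, map_add, map_nsmul] at *
  rw [h1, h2, h3]
  grind

/-- If an end point of the segment of `p` attains the distance to `q`, then `p` lies between it and
`q`, and a geodesic from `p` is a tail of one from that end point. Used at both ends, this reduces
to points of `X`, which are joined by the filling points themselves. -/
theorem pseudoGeodesic (p q : FillPoint ι d) : PseudoGeodesic dist p q := by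
  have hz := zeroHyperbolic hι h
  have hseg : ∀ x y : X, PseudoGeodesic (dist : FillPoint ι d → _ → Λ) (base ι h x)
      (base ι h y) := by
    intro x y
    have hn : 0 ≤ ι (d x y) := by
      have := hι (h.nonneg x y)
      rwa [map_zero] at this
    -- Clamping `s` only makes the path total; its values outside the interval are irrelevant.
    refine ⟨fun s => ⟨x, y, min (max s 0) (ι (d x y)), by simp [hn], by simp⟩, ?_, ?_, ?_⟩
    · rw [hz.symm, dist_base_src hι h ⟨x, y, _, _, _⟩]
      simp [hn]
    · rw [dist_base_base hι h, hz.symm, dist_base_tgt hι h ⟨x, y, _, _, _⟩]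
      simp [hn]
    · rw [dist_base_base hι h]
      intro s hs t ht
      have := h.symm y x
      simp only [dist, lower, endpoint, offset, cond_true, cond_false, h.self, map_zero, this,
        max_eq_left hs.1, max_eq_left ht.1, min_eq_left hs.2, min_eq_left ht.2]
      simp only [Set.mem_Icc] at hs ht
      grind
  have hhalf : ∀ (p : FillPoint ι d) (q : FillPoint ι d),
      (∀ x, PseudoGeodesic dist (base ι h x) q) → PseudoGeodesic dist p q := by
    intro p q hx
    obtain ⟨b, c, hb⟩ := p.exists_dist_eq q
    refine (hx (p.endpoint b)).tail hz ?_
    rw [dist_base_endpoint hι h, hb]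
    have a1 := (base ι h (p.endpoint b)).lower_le_dist q false c
    have a2 := hz.triangle (base ι h (p.endpoint b)) p q
    rw [dist_base_endpoint hι h, hb] at a2
    have a3 : (base ι h (p.endpoint b)).lower q false c =
      ι (d (p.endpoint b) (q.endpoint c)) - q.offset c := by
      simp [lower, base, offset, endpoint]
    rw [a3] at a1
    unfold lower at *
    grind
  exact hhalf p q fun x => (hhalf q _ fun y => hseg y x).symm hz

end

variable {G : Type uG} [Group G] [MulAction G X] {α : G →* OrdAut Λ₀} {β : G →* OrdAut Λ}

/-- The action on the spanned tree induced by an affine action on `X`. -/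
abbrev mulAction (haff : IsAffineAction d α) (hβ : ∀ g a, β g (ι a) = ι (α g a)) :
    MulAction G (FillPoint ι d) where
  smul g p := ⟨g • p.src, g • p.tgt, β g p.pos, OrdAut.map_nonneg _ p.nonneg, by
    rw [haff, ← hβ, map_le_map_iff]
    exact p.le⟩
  one_smul p := by
    apply FillPoint.ext
    · exact one_smul G p.src
    · exact one_smul G p.tgt
    · change β 1 p.pos = p.pos
      rw [map_one, OrdAut.one_apply]
  mul_smul a b p := by
    apply FillPoint.ext
    · exact mul_smul a b p.src
    · exact mul_smul a b p.tgt
    · change β (a * b) p.pos = β a (β b p.pos)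
      rw [map_mul, OrdAut.mul_apply]

end FillPoint

/-- Base change along an order embedding `ι : Λ₀ → Λ`. If each element of `Λ` between `0` and an
element of `ι Λ₀` differs from an element of `ι Λ₀` by an infinitesimal, base change preserves
freeness. -/
theorem IsATFOver.baseChange {G : Type uG} [Group G] {X : Type uX} [MulAction G X]
    {d : X → X → Λ₀} {α : G →* OrdAut Λ₀} (hd : IsLambdaTree d) (haff : IsAffineAction d α)
    (hfree : IsFreeAction G X) (ι : Λ₀ →+ Λ) (hι : StrictMono ι) (β : G →* OrdAut Λ)
    (hβ : ∀ g a, β g (ι a) = ι (α g a))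
    (hinf : ∀ (l : Λ₀) (t : Λ), 0 ≤ t → t ≤ ι l →
      ∃ s, 0 ≤ s ∧ s ≤ l ∧ ∀ ε, 0 < ε → 2 • |t - ι s| < ι ε) :
    IsATFOver.{uG, uL, max uX uL} Λ G := by
  have h := hd.zeroHyperbolic
  have hm := hι.monotone
  let _ : MulAction G (FillPoint ι d) := FillPoint.mulAction haff hβ
  have hz := FillPoint.zeroHyperbolic hm h
  have haff' : IsAffineAction (FillPoint.dist : FillPoint ι d → FillPoint ι d → Λ) β := by
    intro g p q
    have hl : ∀ b c, (g • p).lower (g • q) b c = β g (p.lower q b c) := by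
      have hs : ∀ r : FillPoint ι d, (g • r).src = g • r.src ∧ (g • r).tgt = g • r.tgt ∧
        (g • r).pos = β g r.pos := fun r => ⟨rfl, rfl, rfl⟩
      intro b c
      cases b <;> cases c <;>
      simp only [FillPoint.lower, FillPoint.endpoint, FillPoint.offset, cond_true, cond_false,
        map_sub, hβ, hs, haff g]
    unfold FillPoint.dist
    rw [hl, hl, hl, hl, map_sup, map_sup, map_sup]
  have hbase : ∀ (g : G) x, g • FillPoint.base ι h x = FillPoint.base ι h (g • x) := by
    intro g x
    apply FillPoint.ext
    · rfl
    · rfl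
    · exact map_zero (β g)
  -- The point `σ s` of `X` is infinitesimally close to `p`. If `g` fixes `p`, it moves `σ s` by an
  -- infinitesimal; this displacement comes from `Λ₀`, so it vanishes.
  have hfix : ∀ (g : G) (p : FillPoint ι d), (g • p).dist p = 0 → ∃ u : X, g • u = u := by
    intro g p hp
    obtain ⟨s, hs0, hs1, hs2⟩ := hinf _ _ p.nonneg p.le
    obtain ⟨σ, h0, h1, h2⟩ := hd.geodesic p.src p.tgt
    refine ⟨σ s, ?_⟩
    have e1 : d p.src (σ s) = s := by
      rw [← h0, h2 0 ⟨le_rfl, h.nonneg _ _⟩ s ⟨hs0, hs1⟩, zero_sub, abs_neg, abs_of_nonneg hs0]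
    have e2 : d (σ s) p.tgt = d p.src p.tgt - s := by
      rw [← h1, h2 s ⟨hs0, hs1⟩ _ ⟨h.nonneg _ _, le_rfl⟩, h1]
      grind
    have hb : ∀ t u : Λ, t ≤ u → |t - u| = u - t := by intros; grind
    have hb' : ∀ t u : Λ, u ≤ t → |t - u| = t - u := by intros; grind
    have hpu : p.dist (FillPoint.base ι h (σ s)) = |p.pos - ι s| := by
      have k1 : (FillPoint.base ι h p.src).dist p + p.dist (FillPoint.base ι h p.tgt)
          = (FillPoint.base ι h p.src).dist (FillPoint.base ι h p.tgt) := by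
        rw [FillPoint.dist_base_src hm h, hz.symm p, FillPoint.dist_base_tgt hm h,
          FillPoint.dist_base_base hm h]
        abel
      have k2 : (FillPoint.base ι h p.src).dist (FillPoint.base ι h (σ s)) +
          (FillPoint.base ι h (σ s)).dist (FillPoint.base ι h p.tgt)
          = (FillPoint.base ι h p.src).dist (FillPoint.base ι h p.tgt) := by
        rw [FillPoint.dist_base_base hm h, FillPoint.dist_base_base hm h,
          FillPoint.dist_base_base hm h, e1, e2, map_sub]
        abel
      have k3 : (FillPoint.base ι h p.src).dist (FillPoint.base ι h (σ s)) = ι s := by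
        rw [FillPoint.dist_base_base hm h, e1]
      have k4 := FillPoint.dist_base_src hm h p
      rcases le_total p.pos (ι s) with hle | hle
      · rw [hz.dist_eq_sub k1 k2 (by rw [k3, k4]; exact hle), k3, k4, hb _ _ hle]
      · rw [hz.symm, hz.dist_eq_sub k2 k1 (by rw [k3, k4]; exact hle), k3, k4, hb' _ _ hle]
    by_contra hne
    have hpos : 0 < d (g • σ s) (σ s) :=
      lt_of_le_of_ne (h.nonneg _ _) fun he => hne ((hd.eq_zero_iff _ _).1 he.symm)
    have i1 := hs2 _ hpos
    -- The bound on the error is used at the preimage of the displacement under `α g` and carried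
    -- over by `β g`. Thus the error and its image are each less than half the displacement.
    have i2 : 2 • β g |p.pos - ι s| < ι (d (g • σ s) (σ s)) := by
      have := hs2 _ (OrdAut.map_pos (α g)⁻¹ hpos)
      have := (map_lt_map_iff (β g)).2 this
      rwa [map_nsmul, hβ, OrdAut.apply_inv_self] at this
    have j1 := hz.triangle (FillPoint.base ι h (g • σ s)) (g • p) (FillPoint.base ι h (σ s))
    have j2 := hz.triangle (g • p) p (FillPoint.base ι h (σ s))
    rw [FillPoint.dist_base_base hm h, ← hbase, haff', hz.symm _ p, hpu] at j1
    rw [hp, hpu] at j2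
    grind
  obtain ⟨Y, act, E, π, hE, haffE, hsurj, hEd, heq⟩ :=
    hz.exists_tree (hP := hd.nonempty.map (FillPoint.base ι h))
    (FillPoint.gromovTwice_mem hm h hd.gromov_mem) (FillPoint.pseudoGeodesic hm h) haff'
  have hfixY : ∀ (g : G) (y : Y), g • y = y → ∃ u : X, g • u = u := by
    intro g y hy
    obtain ⟨p, rfl⟩ := hsurj y
    apply hfix g p
    rw [← hEd, heq, hy]
    exact (hE.eq_zero_iff _ _).2 rfl
  refine ⟨Y, act, E, β, hE, haffE, ?_, ?_⟩
  · intro g hg y hy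
    obtain ⟨u, hu⟩ := hfixY g y hy
    exact hfree.1 g hg u hu
  · rintro g ⟨hno, y, hy⟩
    obtain ⟨u, hu⟩ := hfixY _ y hy
    -- A fixed point in `X` would remain one in the new tree, so `g` would be an inversion of `X`.
    refine hfree.2 g ⟨fun x hx => hno (π (FillPoint.base ι h x)) ?_, u, hu⟩
    rw [← heq, hbase, hx]

end BaseChange

end LambdaTree

/-! ### Lexicographic products and a common ordered group. -/

namespace LambdaTree

section LexProduct

variable {I : Type uI} [LinearOrder I] [WellFoundedLT I] (L : I → Type uL)
  [∀ i, AddCommGroup (L i)] [∀ i, LinearOrder (L i)] [∀ i, IsOrderedAddMonoid (L i)]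

open Classical in
/-- The inclusion of a factor into the lexicographic product. -/
noncomputable def lexSingle (i : I) : L i →+ Lex (∀ i, L i) where
  toFun a := toLex (Pi.single i a)
  map_zero' := by rw [Pi.single_zero]; rfl
  map_add' a b := by rw [Pi.single_add]; rfl

theorem lexSingle_same (i : I) (a : L i) : ofLex (lexSingle L i a) i = a :=
  Pi.single_eq_same (M := L) i a

theorem lexSingle_of_ne {i j : I} (h : j ≠ i) (a : L i) : ofLex (lexSingle L i a) j = 0 :=
  Pi.single_eq_of_ne (M := L) h a

theorem lexSingle_strictMono (i : I) : StrictMono (lexSingle L i) := fun a b hab =>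
  ⟨i, fun j hj => by
    change ofLex (lexSingle L i a) j = ofLex (lexSingle L i b) j
    rw [lexSingle_of_ne L hj.ne, lexSingle_of_ne L hj.ne], by
    change ofLex (lexSingle L i a) i < ofLex (lexSingle L i b) i
    rwa [lexSingle_same, lexSingle_same]⟩

open Classical in
/-- An automorphism of a factor acts on the lexicographic product. -/
noncomputable def lexAut (i : I) : OrdAut (L i) →* OrdAut (Lex (∀ i, L i)) where
  toFun e :=
    { toFun := fun f => toLex (Function.update (ofLex f) i (e (ofLex f i)))
      invFun := fun f => toLex (Function.update (ofLex f) i (e⁻¹ (ofLex f i)))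
      left_inv := fun f => by
        simp only [ofLex_toLex, Function.update_self, OrdAut.inv_apply_self, Function.update_idem]
        exact congrArg toLex (Function.update_eq_self i (ofLex f))
      right_inv := fun f => by
        simp only [ofLex_toLex, Function.update_self, OrdAut.apply_inv_self, Function.update_idem]
        exact congrArg toLex (Function.update_eq_self i (ofLex f))
      map_add' := fun f g => by
        apply ofLex.injective
        funext j
        change Function.update (ofLex f + ofLex g) i (e (ofLex f i + ofLex g i)) j =
          Function.update (ofLex f) i (e (ofLex f i)) j +
            Function.update (ofLex g) i (e (ofLex g i)) j
        by_cases hj : j = i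
        · subst hj
          simp only [Function.update_self, map_add]
        · simp only [Function.update_of_ne hj, Pi.add_apply]
      map_le_map_iff' := by
        have key : ∀ (e : OrdAut (L i)) {f g : Lex (∀ i, L i)}, f < g →
            toLex (Function.update (ofLex f) i (e (ofLex f i))) <
              toLex (Function.update (ofLex g) i (e (ofLex g i))) := by
          rintro e f g ⟨j, hj, hlt⟩
          refine ⟨j, fun k hk => ?_, ?_⟩
          · have := hj k hk
            by_cases hki : k = i
            · subst hki
              simpa using this
            · simpa [hki] using this
          · by_cases hji : j = i
            · subst hji
              simpa using (map_lt_map_iff e).2 hlt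
            · simpa [hji] using hlt
        intro f g
        constructor
        · intro hfg
          by_contra hlt
          exact (key e (not_le.1 hlt)).not_ge hfg
        · intro hfg
          rcases hfg.eq_or_lt with rfl | hlt
          · exact le_rfl
          · exact (key e hlt).le }
  map_one' := by
    ext f
    exact congrArg toLex (Function.update_eq_self i (ofLex f))
  map_mul' a b := by
    ext f
    change toLex _ = toLex _
    simp [OrdAut.mul_apply]

theorem lexAut_lexSingle (i : I) (e : OrdAut (L i)) (a : L i) :
    lexAut L i e (lexSingle L i a) = lexSingle L i (e a) := by
  classical
  change toLex (Function.update (Pi.single i a) i (e (Pi.single (M := L) i a i))) =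
    toLex (Pi.single i (e a))
  rw [Pi.single_eq_same]
  congr 1
  funext j
  by_cases hj : j = i
  · subst hj
    simp
  · simp [hj]

/-- Elements of the lexicographic product between `0` and an element of a factor differ from
elements of this factor by infinitesimals. -/
theorem exists_lexSingle_close (i : I) (l : L i) (t : Lex (∀ i, L i)) (h0 : 0 ≤ t)
    (hl : t ≤ lexSingle L i l) :
    ∃ s, 0 ≤ s ∧ s ≤ l ∧ ∀ ε, 0 < ε → 2 • |t - lexSingle L i s| < lexSingle L i ε := by
  -- Both bounds vanish below `i`, so well-founded induction squeezes these coordinates of `t` to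
  -- zero one after the other.
  have hz : ∀ j, j < i → ofLex t j = 0 := by
    intro j
    induction j using WellFoundedLT.induction with
    | ind j ih =>
      intro hj
      have a1 : (0 : L j) ≤ ofLex t j :=
        Pi.apply_le_of_toLex (x := (0 : ∀ i, L i)) (y := ofLex t) h0
          fun k hk => (ih k hk (hk.trans hj)).symm
      have a2 : ofLex t j ≤ ofLex (lexSingle L i l) j :=
        Pi.apply_le_of_toLex (x := ofLex t) hl fun k hk => by
          rw [ih k hk (hk.trans hj), lexSingle_of_ne L (hk.trans hj).ne]
      rw [lexSingle_of_ne L hj.ne] at a2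
      exact le_antisymm a2 a1
  -- What remains after removing the `i`-th coordinate lives beyond `i`, hence is infinitesimal with
  -- respect to the `i`-th factor.
  refine ⟨ofLex t i, ?_, ?_, ?_⟩
  · exact Pi.apply_le_of_toLex (x := (0 : ∀ i, L i)) (y := ofLex t) h0
      fun k hk => (hz k hk).symm
  · have : ofLex t i ≤ ofLex (lexSingle L i l) i :=
      Pi.apply_le_of_toLex (x := ofLex t) hl fun k hk => by
          rw [hz k hk, lexSingle_of_ne L hk.ne]
    rwa [lexSingle_same] at this
  · intro ε hε
    have hu : ∀ j, j ≤ i → ofLex (t - lexSingle L i (ofLex t i)) j = 0 := by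
      intro j hj
      change ofLex t j - ofLex (lexSingle L i (ofLex t i)) j = 0
      rcases hj.eq_or_lt with rfl | hlt
      · rw [lexSingle_same, sub_self]
      · rw [lexSingle_of_ne L hlt.ne, hz j hlt, sub_self]
    have key : ∀ u : Lex (∀ i, L i), (∀ j, j ≤ i → ofLex u j = 0) →
        2 • u < lexSingle L i ε := by
      intro u hu
      refine ⟨i, fun j hj => ?_, ?_⟩
      · change 2 • ofLex u j = ofLex (lexSingle L i ε) j
        rw [hu j hj.le, lexSingle_of_ne L hj.ne, smul_zero]
      · change 2 • ofLex u i < ofLex (lexSingle L i ε) i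
        rwa [hu i le_rfl, lexSingle_same, smul_zero]
    rcases abs_choice (t - lexSingle L i (ofLex t i)) with h | h <;> rw [h]
    · exact key _ hu
    · refine key _ fun j hj => ?_
      change - ofLex (t - lexSingle L i (ofLex t i)) j = 0
      rw [hu j hj, neg_zero]

end LexProduct

/-- Well-ordering the index set makes the full lexicographic product linearly ordered. The group `G
i` acts on it through its own coordinate only, which extends its action on `L i`. -/
theorem exists_common_isATFOver {I : Type uI} (G : I → Type uG) [∀ i, Group (G i)]
    (h : ∀ i, IsATF.{uG, uL, uX} (G i)) :
    ∃ (Λ : Type (max uI uL)) (_ : AddCommGroup Λ) (_ : LinearOrder Λ)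
      (_ : IsOrderedAddMonoid Λ), ∀ i, IsATFOver.{uG, max uI uL, max uX uI uL} Λ (G i) := by
  choose L a1 a2 a3 X a4 d α hd haff hfree using h
  let lo : LinearOrder I := WellOrderingRel.isWellOrder.linearOrder
  have wf : WellFoundedLT I := ⟨WellOrderingRel.isWellOrder.wf⟩
  refine ⟨Lex (∀ i, L i), inferInstance, inferInstance, inferInstance, fun i => ?_⟩
  exact IsATFOver.baseChange (hd i) (haff i) (hfree i) (lexSingle L i) (lexSingle_strictMono L i)
    ((lexAut L i).comp (α i)) (fun g a => lexAut_lexSingle L i (α i g) a)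
    (exists_lexSingle_close L i)

end LambdaTree

/-! ### Lists of letters with twisted distances. -/

namespace LambdaTree

section LetterSystem

variable {Λ : Type uL} [AddCommGroup Λ] [LinearOrder Λ] [IsOrderedAddMonoid Λ]

/-- A set of letters with the distances of a `0`-hyperbolic space with a base point: `len` is the
distance to the base point. Each letter `a` carries an automorphism `twist a` of `Λ`, by which the
distances are scaled behind `a`. -/
structure LetterSystem (A : Type*) (Λ : Type*) [AddCommGroup Λ] [LinearOrder Λ] where
  len : A → Λ
  dist : A → A → Λ
  twist : A → OrdAut Λ
  len_nonneg : ∀ a, 0 ≤ len a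
  symm : ∀ a b, dist a b = dist b a
  dist_le : ∀ a b, dist a b ≤ len a + len b
  len_le : ∀ a b, len a ≤ dist a b + len b
  ultra : ∀ a b c, min (len a + len c - dist a c) (len b + len c - dist b c) ≤
    len a + len b - dist a b
  mem : ∀ a b, ∃ c : Λ, 2 • c = len a + len b - dist a b

/-- Distances from the base point of an ultrametric Gromov product satisfy the four point
condition. -/
theorem four_point_of_ultra {P : Type*} {D : P → P → Λ} {N : P → Λ}
    (symm : ∀ p q, D p q = D q p)
    (ultra : ∀ p q r, min (N p + N r - D p r) (N q + N r - D q r) ≤ N p + N q - D p q)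
    (p q r s : P) : D p q + D r s ≤ max (D p r + D q s) (D p s + D q r) := by
  -- Write `(p·r)` for Gromov products at the base point. If `(p·r)` dominates `(q·r)` and `(p·s)`,
  -- the ultrametric inequality yields `(p·q) ≥ (q·r)` and `(r·s) ≥ (p·s)`, and the sum is the
  -- claim. The cases below bring a dominating product into this position.
  have key : ∀ p q r s : P, N q + N r - D q r ≤ N p + N r - D p r →
      N p + N s - D p s ≤ N p + N r - D p r → D p q + D r s ≤ D p s + D q r := by
    intro p q r s h1 h2
    have u1 := ultra p q r
    have u2 := ultra r s p
    rw [symm r p, symm s p] at u2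
    grind
  by_cases c1 : N q + N r - D q r ≤ N p + N r - D p r
  · by_cases c2 : N p + N s - D p s ≤ N p + N r - D p r
    · exact le_max_of_le_right (key p q r s c1 c2)
    · by_cases c3 : N q + N s - D q s ≤ N p + N s - D p s
      · have := key p q s r c3 (not_le.1 c2).le
        rw [symm r s]
        exact le_max_of_le_left this
      · have := key q p s r (not_le.1 c3).le (by grind)
        rw [symm r s, symm p q]
        refine le_max_of_le_right ?_
        grind
  · by_cases c2 : N q + N s - D q s ≤ N q + N r - D q r
    · have := key q p r s (not_le.1 c1).le c2
      rw [symm p q]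
      refine le_max_of_le_left ?_
      grind
    · by_cases c3 : N p + N s - D p s ≤ N q + N s - D q s
      · have := key q p s r c3 (not_le.1 c2).le
        rw [symm r s, symm p q]
        refine le_max_of_le_right ?_
        grind
      · have := key p q s r (not_le.1 c3).le (by grind)
        rw [symm r s]
        exact le_max_of_le_left this

namespace LetterSystem

variable {A : Type*} (S : LetterSystem A Λ)

/-- The distance of a list of letters from the empty list. -/
def norm : List A → Λ
  | [] => 0
  | a :: p => S.len a + S.twist a (norm p)

open Classical in
/-- The distance between two lists of letters: common letters are cancelled. -/
noncomputable def listDist : List A → List A → Λ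
  | [], q => S.norm q
  | a :: p, [] => S.norm (a :: p)
  | a :: p, b :: q =>
    if a = b then S.twist a (listDist p q)
    else S.dist a b + S.twist a (S.norm p) + S.twist b (S.norm q)

@[simp]
theorem norm_nil : S.norm [] = 0 := rfl

theorem norm_cons (a : A) (p : List A) : S.norm (a :: p) = S.len a + S.twist a (S.norm p) := rfl

@[simp]
theorem listDist_nil_left (q : List A) : S.listDist [] q = S.norm q := by
  rw [listDist]

@[simp]
theorem listDist_nil_right (q : List A) : S.listDist q [] = S.norm q := by
  cases q <;> rw [listDist]

theorem listDist_cons_same (a : A) (p q : List A) :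
    S.listDist (a :: p) (a :: q) = S.twist a (S.listDist p q) := by
  rw [listDist, if_pos rfl]

theorem listDist_cons_of_ne {a b : A} (h : a ≠ b) (p q : List A) :
    S.listDist (a :: p) (b :: q) = S.dist a b + S.twist a (S.norm p) + S.twist b (S.norm q) := by
  rw [listDist, if_neg h]

theorem norm_nonneg (p : List A) : 0 ≤ S.norm p := by
  induction p with
  | nil => exact le_rfl
  | cons a p ih => exact add_nonneg (S.len_nonneg a) (OrdAut.map_nonneg _ ih)

theorem listDist_self (p : List A) : S.listDist p p = 0 := by
  induction p with
  | nil => rw [listDist_nil_left, norm_nil]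
  | cons a p ih => rw [listDist_cons_same, ih, map_zero]

theorem listDist_symm (p q : List A) : S.listDist p q = S.listDist q p := by
  induction p generalizing q with
  | nil => simp
  | cons a p ih =>
    cases q with
    | nil => simp
    | cons b q =>
      by_cases h : a = b
      · subst h
        rw [listDist_cons_same, listDist_cons_same, ih]
      · rw [listDist_cons_of_ne S h, listDist_cons_of_ne S (Ne.symm h), S.symm]
        abel

theorem listDist_le (p q : List A) : S.listDist p q ≤ S.norm p + S.norm q := by
  induction p generalizing q with
  | nil => simp
  | cons a p ih =>
    cases q with
    | nil => simp
    | cons b q =>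
      by_cases h : a = b
      · subst h
        have h1 := (map_le_map_iff (S.twist a)).2 (ih q)
        have h2 := S.len_nonneg a
        rw [listDist_cons_same, norm_cons, norm_cons]
        rw [map_add] at h1
        grind
      · have h1 := S.dist_le a b
        rw [listDist_cons_of_ne S h, norm_cons, norm_cons]
        grind

theorem norm_le (p q : List A) : S.norm p ≤ S.listDist p q + S.norm q := by
  induction p generalizing q with
  | nil =>
    have := S.norm_nonneg q
    simp only [norm_nil, listDist_nil_left]
    grind
  | cons a p ih =>
    cases q with
    | nil => simp
    | cons b q =>
      by_cases h : a = b
      · subst h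
        have h1 := (map_le_map_iff (S.twist a)).2 (ih q)
        rw [listDist_cons_same, norm_cons, norm_cons]
        rw [map_add] at h1
        grind
      · have h1 := S.len_le a b
        have h2 := OrdAut.map_nonneg (S.twist b) (S.norm_nonneg q)
        rw [listDist_cons_of_ne S h, norm_cons, norm_cons]
        grind

/-- If two lists start with different letters, their tails cancel from the Gromov product, which is
then that of the letters; a common first letter contributes twice its length plus the twisted
product of the tails. Three equal letters give the induction step and three different ones the
inequality for letters. If only `p` and `q` share their letter, their product is at least twice its
length, which bounds the mixed products; in the other cases one of the products in the minimum
equals the right-hand side. -/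
theorem listDist_ultra (p q r : List A) :
    min (S.norm p + S.norm r - S.listDist p r) (S.norm q + S.norm r - S.listDist q r) ≤
      S.norm p + S.norm q - S.listDist p q := by
  induction p generalizing q r with
  | nil => simp
  | cons a p ih =>
    cases q with
    | nil => simp
    | cons b q =>
      cases r with
      | nil =>
        have := S.listDist_le (a :: p) (b :: q)
        simp only [listDist_nil_right, norm_nil]
        grind
      | cons c r =>
        have hu := S.ultra a b c
        have hs := S.symm a b
        by_cases h1 : a = b
        · subst h1
          by_cases h2 : a = c
          · subst h2
            have h3 := (map_le_map_iff (S.twist a)).2 (ih q r)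
            simp only [listDist_cons_same, norm_cons]
            rw [map_inf] at h3
            simp only [map_sub, map_add] at h3
            grind
          · have h3 := (map_le_map_iff (S.twist a)).2 (S.listDist_le p q)
            have h4 := S.len_le c a
            have h5 := S.symm c a
            simp only [listDist_cons_same, listDist_cons_of_ne S h2, norm_cons]
            rw [map_add] at h3
            grind
        · by_cases h2 : a = c
          · subst h2
            have h3 := S.listDist_symm (a :: p) (b :: q)
            rw [h3, add_comm (S.norm (a :: p)) (S.norm (b :: q))]
            have h4 := (map_le_map_iff (S.twist a)).2 (S.norm_le p r)
            have h5 := S.len_nonneg a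
            simp only [listDist_cons_of_ne S (Ne.symm h1), norm_cons]
            exact min_le_of_right_le (by grind)
          · by_cases h3 : b = c
            · subst h3
              refine min_le_of_left_le ?_
              simp only [listDist_cons_of_ne S h1, norm_cons]
              grind
            · simp only [listDist_cons_of_ne S h1, listDist_cons_of_ne S h2,
                listDist_cons_of_ne S h3, norm_cons]
              grind

theorem zeroHyperbolic : ZeroHyperbolic S.listDist where
  self := S.listDist_self
  symm := S.listDist_symm
  four_point := four_point_of_ultra S.listDist_symm S.listDist_ultra

theorem exists_two_nsmul_eq (p q : List A) :
    ∃ c : Λ, 2 • c = S.norm p + S.norm q - S.listDist p q := by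
  induction p generalizing q with
  | nil => exact ⟨0, by simp⟩
  | cons a p ih =>
    cases q with
    | nil => exact ⟨0, by simp⟩
    | cons b q =>
      by_cases h : a = b
      · subst h
        obtain ⟨c, hc⟩ := ih q
        refine ⟨S.len a + S.twist a c, ?_⟩
        rw [smul_add, ← map_nsmul, hc, listDist_cons_same, norm_cons, norm_cons, map_sub, map_add]
        abel
      · obtain ⟨c, hc⟩ := S.mem a b
        refine ⟨c, ?_⟩
        rw [hc, listDist_cons_of_ne S h, norm_cons, norm_cons]
        abel

theorem gromovTwice_mem (v p q : List A) : ∃ c : Λ, 2 • c = gromovTwice S.listDist v p q := by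
  obtain ⟨c1, h1⟩ := S.exists_two_nsmul_eq p v
  obtain ⟨c2, h2⟩ := S.exists_two_nsmul_eq q v
  obtain ⟨c3, h3⟩ := S.exists_two_nsmul_eq p q
  refine ⟨S.norm v + c3 - c1 - c2, ?_⟩
  unfold gromovTwice
  grind

/-- A list lying between the empty list and `q` is at most one letter longer than `q`, if all its
letters but the last have positive length. -/
theorem length_le_of_between (p q : List A) (hp : p.IsChain fun a _ => 0 < S.len a)
    (hpq : S.norm p + S.listDist p q = S.norm q) : p.length ≤ q.length + 1 := by
  induction p generalizing q with
  | nil => simp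
  | cons a p ih =>
    cases q with
    | nil =>
      have h1 := S.norm_nonneg (a :: p)
      rw [listDist_nil_right, norm_nil] at hpq
      cases p with
      | nil => simp
      | cons b p =>
        have h2 : 0 < S.len a := (List.isChain_cons_cons.1 hp).1
        have h3 := OrdAut.map_nonneg (S.twist a) (S.norm_nonneg (b :: p))
        rw [norm_cons] at hpq
        grind
    | cons c q =>
      by_cases h : a = c
      · subst h
        rw [listDist_cons_same, norm_cons, norm_cons, add_assoc, add_right_inj, ← map_add,
          EmbeddingLike.apply_eq_iff_eq] at hpq
        simpa using ih q hp.tail hpq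
      -- After the first differing letter, the tail of `p` is a detour counted twice, so it has norm
      -- zero. By positivity it then has at most one letter, which accounts for the `+ 1`.
      · have h1 := S.len_le c a
        have h2 := S.symm c a
        have h4 := S.len_nonneg a
        have h3 := OrdAut.map_nonneg (S.twist a) (S.norm_nonneg p)
        rw [listDist_cons_of_ne S h, norm_cons, norm_cons] at hpq
        have h5 : S.twist a (S.norm p) = 0 := by grind
        rw [OrdAut.map_eq_zero] at h5
        cases p with
        | nil => simp
        | cons b p =>
          cases p with
          | nil => simp
          | cons e p =>
            have h6 : 0 < S.len b := (List.isChain_cons_cons.1 hp.tail).1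
            have h7 := OrdAut.map_nonneg (S.twist b) (S.norm_nonneg (e :: p))
            rw [norm_cons] at h5
            grind

end LetterSystem

end LetterSystem

end LambdaTree

/-! ### Reduced words, and the wedge of the given trees. -/

namespace LambdaTree

open Monoid (CoprodI)
open Monoid.CoprodI (of Word)

/-- A set `X` with a base point `x₀`, made into a monoid with unit `x₀` in which the first factor
different from `x₀` wins. -/
def PointedSet (X : Type*) (_ : X) : Type _ := X

open Classical in
/-- The product of a pointed set: the first factor different from `x₀` wins. -/
noncomputable def PointedSet.mul {X : Type*} (x₀ a b : X) : X := if a = x₀ then b else a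

theorem PointedSet.mul_assoc {X : Type*} (x₀ a b c : X) :
    mul x₀ (mul x₀ a b) c = mul x₀ a (mul x₀ b c) := by
  by_cases h : a = x₀
  · rw [mul, mul, mul, mul, if_pos h, if_pos h]
  · simp [mul, h]

theorem PointedSet.mul_base {X : Type*} (x₀ a : X) : mul x₀ a x₀ = a := by
  by_cases h : a = x₀ <;> simp [mul, h]

/-- The action only uses products of the form `(a, 1) * (b, x) = (a * b, x)`. The monoid structure
makes `(1, x₀)` the trivial letter, so that reduced words in a free product of monoids can code
points. -/
noncomputable instance (X : Type*) (x₀ : X) : Monoid (PointedSet X x₀) where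
  one := x₀
  mul := PointedSet.mul x₀
  mul_assoc := PointedSet.mul_assoc x₀
  one_mul _ := if_pos rfl
  mul_one := PointedSet.mul_base x₀

section Reduced

open scoped Classical

variable {I : Type uI} {G : I → Type uG} [∀ i, Group (G i)]

/-- The reduced word of `g` does not start with a letter of the `i`-th factor. -/
abbrev NotStart (i : I) (g : CoprodI G) : Prop := (Word.equiv g).fstIdx ≠ some i

theorem equiv_of_mul (i : I) (a : G i) (g : CoprodI G) :
    Word.equiv (of a * g) = of a • Word.equiv g := by
  change (of a * g) • (Word.empty : Word G) = of a • (g • (Word.empty : Word G))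
  rw [mul_smul]

theorem equiv_one : Word.equiv (1 : CoprodI G) = Word.empty := by
  change (1 : CoprodI G) • (Word.empty : Word G) = Word.empty
  rw [one_smul]

theorem notStart_one (i : I) : NotStart i (1 : CoprodI G) := by
  simp [NotStart, equiv_one, Word.fstIdx, Word.empty]

theorem equiv_of_mul_of_notStart {i : I} {a : G i} (ha : a ≠ 1) {g : CoprodI G}
    (hg : NotStart i g) : Word.equiv (of a * g) = Word.cons a (Word.equiv g) hg ha := by
  rw [equiv_of_mul, Word.cons_eq_smul]

theorem fstIdx_equiv_of_mul {i : I} {a : G i} (ha : a ≠ 1) {g : CoprodI G}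
    (hg : NotStart i g) : (Word.equiv (of a * g)).fstIdx = some i := by
  rw [equiv_of_mul_of_notStart ha hg, Word.fstIdx_cons]

theorem notStart_of_mul {i j : I} (hij : i ≠ j) {a : G j} (ha : a ≠ 1) {g : CoprodI G}
    (hg : NotStart j g) : NotStart i (of a * g) := by
  rw [NotStart, fstIdx_equiv_of_mul ha hg]
  simpa using hij.symm

theorem exists_of_mul (i : I) (g : CoprodI G) : ∃ (a : G i) (g' : CoprodI G),
    g = of a * g' ∧ NotStart i g' := by
  refine ⟨(Word.equivPair i (Word.equiv g)).head,
    Word.equiv.symm (Word.equivPair i (Word.equiv g)).tail, ?_, ?_⟩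
  · apply Word.equiv.injective
    rw [equiv_of_mul, Equiv.apply_symm_apply, Word.equivPair_head_smul_equivPair_tail]
  · rw [NotStart, Equiv.apply_symm_apply]
    exact (Word.equivPair i (Word.equiv g)).fstIdx_ne

@[elab_as_elim]
theorem reduced_induction {motive : CoprodI G → Prop} (g : CoprodI G) (one : motive 1)
    (mul : ∀ (i) (a : G i) (g), a ≠ 1 → NotStart i g → motive g → motive (of a * g)) :
    motive g := by
  rw [← Word.equiv.symm_apply_apply g]
  induction Word.equiv g using Word.consRecOn with
  | empty => exact one
  | cons i a w h1 h2 ih =>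
    have : Word.equiv.symm (Word.cons a w h1 h2) = of a * Word.equiv.symm w := Word.prod_cons _ _ _ h2 h1
    rw [this]
    refine mul i a _ h2 ?_ ih
    rwa [NotStart, Equiv.apply_symm_apply]

end Reduced

/-- A family of affine actions on pointed `Λ`-trees. -/
structure PointedFamily {I : Type uI} (G : I → Type uG) [∀ i, Group (G i)]
    (Λ : Type uL) [AddCommGroup Λ] [LinearOrder Λ] where
  X : I → Type uX
  act : ∀ i, MulAction (G i) (X i)
  d : ∀ i, X i → X i → Λ
  α : ∀ i, G i →* OrdAut Λ
  tree : ∀ i, IsLambdaTree (d i)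
  affine : ∀ i, IsAffineAction (d i) (α i)
  base : ∀ i, X i

namespace PointedFamily

open scoped Classical

attribute [instance] act

variable {I : Type uI} {G : I → Type uG} [∀ i, Group (G i)]
  {Λ : Type uL} [AddCommGroup Λ] [LinearOrder Λ] [IsOrderedAddMonoid Λ]
  (F : PointedFamily.{uI, uG, uL, uX} G Λ)

theorem hyp (i : I) : ZeroHyperbolic (F.d i) := (F.tree i).zeroHyperbolic

/-- The distance on the wedge of the trees at their base points. -/
noncomputable def wedgeDist (a b : Σ i, F.X i) : Λ :=
  if h : a.1 = b.1 then F.d b.1 (h ▸ a.2) b.2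
  else F.d a.1 (F.base a.1) a.2 + F.d b.1 (F.base b.1) b.2

theorem wedgeDist_same {i : I} (x y : F.X i) : F.wedgeDist ⟨i, x⟩ ⟨i, y⟩ = F.d i x y := by
  simp [wedgeDist]

theorem wedgeDist_of_ne {i j : I} (h : i ≠ j) (x : F.X i) (y : F.X j) :
    F.wedgeDist ⟨i, x⟩ ⟨j, y⟩ = F.d i (F.base i) x + F.d j (F.base j) y := by
  simp [wedgeDist, h]

/-- The letters of the `i`-th factor: group elements together with a point of `X i`. -/
abbrev Mon (i : I) : Type _ := G i × PointedSet (F.X i) (F.base i)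

/-- The point of `X i` determined by a letter. -/
def pos {i : I} (m : F.Mon i) : F.X i := @HSMul.hSMul (G i) (F.X i) (F.X i) _ m.1 m.2

theorem pos_one {i : I} : F.pos (1 : F.Mon i) = F.base i := one_smul _ _

theorem pos_mul {i : I} (a : G i) (m : F.Mon i) : F.pos ((a, 1) * m) = a • F.pos m := by
  have h : ((a, 1) * m : F.Mon i) = (a * m.1, m.2) := Prod.ext rfl (one_mul m.2)
  rw [h]
  exact mul_smul (α := G i) (β := F.X i) a m.1 m.2

/-- The letters with the distances of the wedge. -/
noncomputable def letters : LetterSystem (Σ i, F.Mon i) Λ where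
  len a := F.d a.1 (F.base a.1) (F.pos a.2)
  dist a b := F.wedgeDist ⟨a.1, F.pos a.2⟩ ⟨b.1, F.pos b.2⟩
  twist a := F.α a.1 a.2.1
  len_nonneg a := (F.hyp a.1).nonneg _ _
  symm := by
    rintro ⟨i, a⟩ ⟨j, b⟩
    by_cases h : i = j
    · subst h
      rw [wedgeDist_same, wedgeDist_same, (F.hyp i).symm]
    · rw [wedgeDist_of_ne F h, wedgeDist_of_ne F (Ne.symm h), add_comm]
  dist_le := by
    rintro ⟨i, a⟩ ⟨j, b⟩
    by_cases h : i = j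
    · subst h
      rw [wedgeDist_same, (F.hyp i).symm (F.base i) (F.pos a)]
      exact (F.hyp i).triangle _ _ _
    · rw [wedgeDist_of_ne F h]
  len_le := by
    rintro ⟨i, a⟩ ⟨j, b⟩
    by_cases h : i = j
    · subst h
      rw [wedgeDist_same, (F.hyp i).symm (F.pos a) (F.pos b), add_comm]
      exact (F.hyp i).triangle _ _ _
    · have := (F.hyp j).nonneg (F.base j) (F.pos b)
      rw [wedgeDist_of_ne F h]
      grind
  ultra := by
    rintro ⟨i, a⟩ ⟨j, b⟩ ⟨k, c⟩
    by_cases h : i = j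
    · subst h
      by_cases h2 : i = k
      · subst h2
        have h3 := (F.hyp i).min_gromovTwice_le (F.base i) (F.pos a) (F.pos b) (F.pos c)
        have := (F.hyp i).symm (F.pos a) (F.base i)
        have := (F.hyp i).symm (F.pos b) (F.base i)
        have := (F.hyp i).symm (F.pos c) (F.base i)
        unfold gromovTwice at h3
        simp only [wedgeDist_same]
        grind
      · have h3 := (F.hyp i).triangle (F.pos a) (F.base i) (F.pos b)
        have := (F.hyp i).symm (F.pos a) (F.base i)
        rw [wedgeDist_same, wedgeDist_of_ne F h2, wedgeDist_of_ne F h2]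
        grind
    · rw [wedgeDist_of_ne F h]
      by_cases h2 : i = k
      · subst h2
        rw [wedgeDist_of_ne F (Ne.symm h)]
        exact min_le_of_right_le (by grind)
      · rw [wedgeDist_of_ne F h2]
        exact min_le_of_left_le (by grind)
  mem := by
    rintro ⟨i, a⟩ ⟨j, b⟩
    by_cases h : i = j
    · subst h
      obtain ⟨c, hc⟩ := (F.tree i).gromov_mem (F.base i) (F.pos a) (F.pos b)
      refine ⟨c, ?_⟩
      have := (F.hyp i).symm (F.pos a) (F.base i)
      have := (F.hyp i).symm (F.pos b) (F.base i)
      unfold gromovTwice at hc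
      rw [wedgeDist_same]
      grind
    · refine ⟨0, ?_⟩
      rw [wedgeDist_of_ne F h]
      simp

/-- The distance of a word from the empty word. -/
noncomputable def wordNorm (w : Word F.Mon) : Λ := F.letters.norm w.toList

/-- The distance of two words. -/
noncomputable def wordDist (w w' : Word F.Mon) : Λ := F.letters.listDist w.toList w'.toList

theorem wordNorm_empty : F.wordNorm Word.empty = 0 := rfl

theorem wordDist_empty (w : Word F.Mon) : F.wordDist Word.empty w = F.wordNorm w :=
  F.letters.listDist_nil_left _

/-- A trivial head sits at the base point and has trivial twist, so one formula covers words with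
and without a first letter in the `i`-th factor. -/
theorem wordNorm_rcons {i : I} (p : Word.Pair F.Mon i) :
    F.wordNorm (Word.rcons p) =
      F.d i (F.base i) (F.pos p.head) + F.α i p.head.1 (F.wordNorm p.tail) := by
  by_cases h : p.head = 1
  · rw [Word.rcons, dif_pos h, h, pos_one, (F.hyp i).self, Prod.fst_one, map_one,
      OrdAut.one_apply, zero_add]
  · rw [Word.rcons, dif_neg h]
    rfl

theorem wordDist_rcons_same {i : I} {p q : Word.Pair F.Mon i} (hpq : p.head = q.head) :
    F.wordDist (Word.rcons p) (Word.rcons q) = F.α i p.head.1 (F.wordDist p.tail q.tail) := by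
  by_cases h : p.head = 1
  · rw [Word.rcons, dif_pos h, Word.rcons, dif_pos (hpq ▸ h), h, Prod.fst_one, map_one,
      OrdAut.one_apply]
  · rw [Word.rcons, dif_neg h, Word.rcons, dif_neg (hpq ▸ h)]
    unfold wordDist
    rw [Word.cons_toList, Word.cons_toList, ← hpq, LetterSystem.listDist_cons_same]
    rfl

theorem wordDist_cons_of_fstIdx_ne {i : I} {w : Word F.Mon} (hw : w.fstIdx ≠ some i)
    (q : Word.Pair F.Mon i) (hq : q.head ≠ 1) :
    F.wordDist w (Word.cons q.head q.tail q.fstIdx_ne hq) =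
      F.wordNorm w + F.d i (F.base i) (F.pos q.head) + F.α i q.head.1 (F.wordNorm q.tail) := by
  have h1 := Word.fstIdx_ne_iff.1 hw
  unfold wordDist wordNorm
  rw [Word.cons_toList]
  cases hl : w.toList with
  | nil =>
    rw [LetterSystem.listDist_nil_left, LetterSystem.norm_nil, zero_add, LetterSystem.norm_cons]
    rfl
  | cons b l =>
    rw [hl] at h1
    have hib : i ≠ b.1 := h1 b rfl
    have hne : b ≠ ⟨i, q.head⟩ := by
      rintro rfl
      exact hib rfl
    rw [LetterSystem.listDist_cons_of_ne _ hne, LetterSystem.norm_cons]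
    change F.wedgeDist ⟨b.1, F.pos b.2⟩ ⟨i, F.pos q.head⟩ + F.α b.1 b.2.1 _ + F.α i q.head.1 _ =
      F.d b.1 (F.base b.1) (F.pos b.2) + F.α b.1 b.2.1 _ + _ + _
    rw [wedgeDist_of_ne F hib.symm]
    abel

theorem wordDist_symm (w w' : Word F.Mon) : F.wordDist w w' = F.wordDist w' w :=
  F.letters.listDist_symm _ _

theorem wordDist_rcons_of_ne {i : I} {p q : Word.Pair F.Mon i} (hpq : p.head ≠ q.head) :
    F.wordDist (Word.rcons p) (Word.rcons q) = F.d i (F.pos p.head) (F.pos q.head) +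
      F.α i p.head.1 (F.wordNorm p.tail) + F.α i q.head.1 (F.wordNorm q.tail) := by
  by_cases h : p.head = 1
  · have h' : q.head ≠ 1 := fun h' => hpq (h.trans h'.symm)
    rw [Word.rcons, dif_pos h, Word.rcons, dif_neg h', wordDist_cons_of_fstIdx_ne F p.fstIdx_ne,
      h, pos_one, Prod.fst_one, map_one, OrdAut.one_apply]
    abel
  · by_cases h' : q.head = 1
    · rw [wordDist_symm, Word.rcons, dif_pos h', Word.rcons, dif_neg h,
        wordDist_cons_of_fstIdx_ne F q.fstIdx_ne, h', pos_one, Prod.fst_one, map_one,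
        OrdAut.one_apply, (F.hyp i).symm]
      abel
    · rw [Word.rcons, dif_neg h, Word.rcons, dif_neg h']
      unfold wordDist
      have hne : (⟨i, p.head⟩ : Σ i, F.Mon i) ≠ ⟨i, q.head⟩ := fun he =>
        hpq (eq_of_heq (Sigma.mk.inj he).2)
      rw [Word.cons_toList, Word.cons_toList, LetterSystem.listDist_cons_of_ne _ hne]
      change F.wedgeDist ⟨i, F.pos p.head⟩ ⟨i, F.pos q.head⟩ + F.α i p.head.1 _ +
        F.α i q.head.1 _ = _
      rw [wedgeDist_same]
      rfl

/-- If one of the tails is empty, the formula for the distance of words with different heads is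
valid in general. -/
theorem wordDist_rcons_of_tail_eq_empty {i : I} {p q : Word.Pair F.Mon i}
    (hp : p.tail = Word.empty) :
    F.wordDist (Word.rcons p) (Word.rcons q) = F.d i (F.pos p.head) (F.pos q.head) +
      F.α i q.head.1 (F.wordNorm q.tail) := by
  by_cases hpq : p.head = q.head
  · rw [wordDist_rcons_same F hpq, hp, wordDist_empty, hpq, (F.hyp i).self, zero_add]
  · rw [wordDist_rcons_of_ne F hpq, hp, wordNorm_empty, map_zero, add_zero]

/-- The action of the free product on words of letters. -/
noncomputable def toMon : CoprodI G →* CoprodI F.Mon :=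
  CoprodI.lift fun i => of.comp (MonoidHom.inl (G i) (PointedSet (F.X i) (F.base i)))

theorem toMon_of_smul {i : I} (a : G i) (p : Word.Pair F.Mon i) :
    F.toMon (of a) • Word.rcons p =
      Word.rcons { p with head := (a, 1) * p.head } := by
  have h1 : F.toMon (of a) = of (M := F.Mon) (i := i) (a, 1) := by
    simp [toMon]
  have h2 : Word.equivPair i (Word.rcons p) = p := (Word.equivPair i).apply_symm_apply p
  rw [h1, Word.of_smul_def]
  simp only [h2]

/-- One syllable `a` of `g` is treated at a time. Give both words a possibly trivial head in the
factor of `a`: the action multiplies the heads by `(a, 1)`, leaves the tails alone, and keeps equal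
heads equal and different heads different. Each distance formula is then scaled by the automorphism
of `a`. -/
theorem wordDist_smul (g : CoprodI G) (w w' : Word F.Mon) :
    F.wordDist (F.toMon g • w) (F.toMon g • w') = CoprodI.lift F.α g (F.wordDist w w') := by
  induction g using CoprodI.induction_left generalizing w w' with
  | one => simp [OrdAut.one_apply]
  | @mul i a g ih =>
    have key : ∀ w w' : Word F.Mon, F.wordDist (F.toMon (of a) • w) (F.toMon (of a) • w') =
        F.α i a (F.wordDist w w') := by
      intro w w'
      obtain ⟨p, rfl⟩ := (Word.equivPair i).symm.surjective w
      obtain ⟨q, rfl⟩ := (Word.equivPair i).symm.surjective w'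
      rw [Word.equivPair_symm, Word.equivPair_symm, toMon_of_smul, toMon_of_smul]
      by_cases hpq : p.head = q.head
      · rw [wordDist_rcons_same F hpq, wordDist_rcons_same F (by rw [hpq]), ← OrdAut.mul_apply,
          ← map_mul]
        rfl
      · have hpq' : ((a, 1) : F.Mon i) * p.head ≠ (a, 1) * q.head := by
          intro he
          apply hpq
          have h1 := congrArg Prod.fst he
          have h2 := congrArg Prod.snd he
          simp only [Prod.fst_mul, Prod.snd_mul, one_mul, mul_right_inj] at h1 h2
          exact Prod.ext h1 h2
        rw [wordDist_rcons_of_ne F hpq, wordDist_rcons_of_ne F hpq', map_add, map_add,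
          ← F.affine, pos_mul, pos_mul, Prod.fst_mul, Prod.fst_mul, map_mul, map_mul,
          OrdAut.mul_apply, OrdAut.mul_apply]
    rw [map_mul, mul_smul, mul_smul, key, ih, map_mul, OrdAut.mul_apply, CoprodI.lift_of]

end PointedFamily

end LambdaTree

/-! ### The pseudometric space carrying the action of the free product. -/

namespace LambdaTree

open Monoid (CoprodI)
open Monoid.CoprodI (of Word)

namespace PointedFamily

open scoped Classical

variable {I : Type uI} {G : I → Type uG} [∀ i, Group (G i)]
  {Λ : Type uL} [AddCommGroup Λ] [LinearOrder Λ] [IsOrderedAddMonoid Λ]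
  (F : PointedFamily.{uI, uG, uL, uX} G Λ)

/-- Representatives for the points of the tree of the free product: translates of the points of
the trees `X i` and of a common base point. -/
@[ext]
structure Point where
  elt : CoprodI G
  pt : Option (Σ i, F.X i)

namespace Point

variable {F}

instance : MulAction (CoprodI G) F.Point where
  smul g p := ⟨g * p.elt, p.pt⟩
  one_smul _ := Point.ext (one_mul _) rfl
  mul_smul g h p := Point.ext (mul_assoc g h p.elt) rfl

theorem smul_mk (g h : CoprodI G) (o : Option (Σ i, F.X i)) :
    g • (⟨h, o⟩ : F.Point) = ⟨g * h, o⟩ := rfl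

/-- The common base point. -/
def origin : F.Point := ⟨1, none⟩

/-- The inclusion of `X i`. -/
def emb (i : I) (x : F.X i) : F.Point := ⟨1, some ⟨i, x⟩⟩

/-- The word of a point of the wedge. -/
noncomputable def start : Option (Σ i, F.X i) → Word F.Mon
  | none => Word.empty
  | some a => Word.rcons (i := a.1) ⟨(1, a.2), Word.empty, by simp [Word.fstIdx, Word.empty]⟩

/-- The word of letters of a point. -/
noncomputable def word (p : F.Point) : Word F.Mon := F.toMon p.elt • start p.pt

/-- The distance from the base point. -/
noncomputable def norm (p : F.Point) : Λ := F.wordNorm p.word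

/-- The distance. -/
noncomputable def dist (p q : F.Point) : Λ := F.wordDist p.word q.word

/-- The word of `p` does not start with a letter of the `i`-th factor. -/
abbrev Apart (i : I) (p : F.Point) : Prop := p.word.fstIdx ≠ some i

theorem word_smul (g : CoprodI G) (p : F.Point) : (g • p).word = F.toMon g • p.word := by
  change F.toMon (g * p.elt) • start p.pt = F.toMon g • F.toMon p.elt • start p.pt
  rw [map_mul, mul_smul]

theorem word_origin : (origin : F.Point).word = Word.empty := by
  change F.toMon 1 • (Word.empty : Word F.Mon) = Word.empty
  rw [map_one, one_smul]

theorem word_of_smul {i : I} (a : G i) {p : F.Point} (hp : p.Apart i) :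
    (of a • p).word = Word.rcons (⟨(a, 1), p.word, hp⟩ : Word.Pair F.Mon i) := by
  have h1 : Word.rcons (⟨1, p.word, hp⟩ : Word.Pair F.Mon i) = p.word := dif_pos rfl
  rw [word_smul]
  conv_lhs => rw [← h1]
  rw [toMon_of_smul]
  simp only [mul_one]

theorem fstIdx_empty_ne (i : I) : (Word.empty : Word F.Mon).fstIdx ≠ some i := by
  simp [Word.fstIdx, Word.empty]

theorem word_of_smul_emb {i : I} (a : G i) (x : F.X i) :
    (of a • emb i x).word =
      Word.rcons (⟨(a, x), Word.empty, fstIdx_empty_ne i⟩ : Word.Pair F.Mon i) := by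
  have h1 : (emb i x).word =
      Word.rcons (⟨(1, x), Word.empty, fstIdx_empty_ne i⟩ : Word.Pair F.Mon i) := by
    change F.toMon 1 • start _ = _
    rw [map_one, one_smul]
    rfl
  rw [word_smul, h1, toMon_of_smul]
  have h2 : ((a, 1) : F.Mon i) * ((1, x) : F.Mon i) = (a, x) :=
    Prod.ext (mul_one a) (one_mul (M := PointedSet (F.X i) (F.base i)) x)
  simp only [h2]
  rfl

theorem word_emb (i : I) (x : F.X i) : (emb i x).word =
      Word.rcons (⟨(1, x), Word.empty, fstIdx_empty_ne i⟩ : Word.Pair F.Mon i) := by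
  rw [← word_of_smul_emb, map_one, one_smul]

theorem apart_origin (i : I) : (origin : F.Point).Apart i := by
  rw [Apart, word_origin]
  exact fstIdx_empty_ne i

theorem apart_rcons {i j : I} (hij : i ≠ j) (p : Word.Pair F.Mon j)
    (hp : p.head ≠ 1 ∨ p.tail.fstIdx ≠ some i) : (Word.rcons p).fstIdx ≠ some i := by
  by_cases h : p.head = 1
  · rw [Word.rcons, dif_pos h]
    exact hp.resolve_left (not_not.2 h)
  · rw [Word.rcons, dif_neg h, Word.fstIdx_cons]
    simpa using hij.symm

theorem apart_emb {i j : I} (hij : i ≠ j) (x : F.X j) : (emb j x).Apart i := by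
  rw [Apart, word_emb]
  exact apart_rcons hij _ (Or.inr (fstIdx_empty_ne i))

theorem mk_eq_smul (g : CoprodI G) (o : Option (Σ i, F.X i)) :
    (⟨g, o⟩ : F.Point) = g • ⟨1, o⟩ := by
  rw [smul_mk, mul_one]

/-- The word of `⟨g, o⟩` does not start in the `i`-th factor if `g` does not, unless `g = 1` and
`o` is a point of `X i`. -/
theorem apart_of_notStart {i : I} {g : CoprodI G} (hg : NotStart i g) {o : Option (Σ i, F.X i)}
    (ho : g = 1 → o.map Sigma.fst ≠ some i) : (⟨g, o⟩ : F.Point).Apart i := by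
  induction g using reduced_induction generalizing i with
  | one =>
    rcases o with _ | ⟨j, x⟩
    · exact apart_origin i
    · refine apart_emb (fun hij => ho rfl ?_) x
      simp [hij]
  | mul j a g ha hgj ih =>
    have hij : i ≠ j := by
      rintro rfl
      exact hg (fstIdx_equiv_of_mul ha hgj)
    by_cases hcase : g = 1 ∧ o.map Sigma.fst = some j
    · obtain ⟨rfl, ho'⟩ := hcase
      rcases o with _ | ⟨k, x⟩
      · simp at ho'
      · obtain rfl : k = j := by simpa using ho'
        rw [Apart, mul_one, mk_eq_smul]
        change (of a • (emb k x : F.Point)).word.fstIdx ≠ _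
        rw [word_of_smul_emb]
        exact apart_rcons hij _ (Or.inr (fstIdx_empty_ne i))
    · have h1 := ih hgj fun h1 h2 => hcase ⟨h1, h2⟩
      have h2 : (⟨of a * g, o⟩ : F.Point) = of a • ⟨g, o⟩ := rfl
      rw [h2, Apart, word_of_smul a h1]
      refine apart_rcons hij _ (Or.inl fun h => ha ?_)
      exact congrArg Prod.fst h

/-- Each point is a point of a translate of `X i` or lies behind a translate of the base point. -/
theorem exists_form (i : I) (p : F.Point) :
    (∃ (a : G i) (x : F.X i), p = of a • emb i x) ∨
      ∃ (a : G i) (q : F.Point), p = of a • q ∧ q.Apart i := by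
  obtain ⟨g, o⟩ := p
  obtain ⟨a, g, rfl, hg⟩ := exists_of_mul i g
  by_cases hcase : g = 1 ∧ o.map Sigma.fst = some i
  · obtain ⟨rfl, ho⟩ := hcase
    rcases o with _ | ⟨k, x⟩
    · simp at ho
    · obtain rfl : k = i := by simpa using ho
      exact Or.inl ⟨a, x, rfl⟩
  · exact Or.inr ⟨a, ⟨g, o⟩, rfl, apart_of_notStart hg fun h1 h2 => hcase ⟨h1, h2⟩⟩

theorem dist_smul (g : CoprodI G) (p q : F.Point) :
    dist (g • p) (g • q) = CoprodI.lift F.α g (dist p q) := by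
  rw [dist, word_smul, word_smul, wordDist_smul]
  rfl

theorem isAffineAction : IsAffineAction (dist : F.Point → F.Point → Λ) (CoprodI.lift F.α) :=
  dist_smul

theorem dist_origin (p : F.Point) : dist origin p = p.norm := by
  rw [dist, word_origin, wordDist_empty]
  rfl

theorem norm_nonneg (p : F.Point) : 0 ≤ p.norm := F.letters.norm_nonneg _

theorem norm_of_smul {i : I} (a : G i) {p : F.Point} (hp : p.Apart i) :
    (of a • p).norm = F.d i (F.base i) (a • F.base i) + F.α i a p.norm := by
  rw [norm, word_of_smul a hp, wordNorm_rcons]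
  rfl

theorem norm_of_smul_emb {i : I} (a : G i) (x : F.X i) :
    (of a • emb i x).norm = F.d i (F.base i) (a • x) := by
  rw [norm, word_of_smul_emb, wordNorm_rcons, wordNorm_empty, map_zero, add_zero]
  rfl

theorem dist_emb_of_smul {i : I} (x : F.X i) (a : G i) {p : F.Point} (hp : p.Apart i) :
    dist (emb i x) (of a • p) = F.d i x (a • F.base i) + F.α i a p.norm := by
  have hx : F.pos ((1, x) : F.Mon i) = x := one_smul _ _
  rw [dist, word_emb, word_of_smul a hp, wordDist_rcons_of_tail_eq_empty F rfl, hx]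
  rfl

theorem dist_emb_of_smul_emb {i : I} (x : F.X i) (a : G i) (y : F.X i) :
    dist (emb i x) (of a • emb i y) = F.d i x (a • y) := by
  have hx : F.pos ((1, x) : F.Mon i) = x := one_smul _ _
  rw [dist, word_emb, word_of_smul_emb, wordDist_rcons_of_tail_eq_empty F rfl, hx,
    wordNorm_empty, map_zero, add_zero]
  rfl

theorem dist_emb_emb {i : I} (x y : F.X i) : dist (emb i x) (emb i y) = F.d i x y := by
  have := dist_emb_of_smul_emb x (1 : G i) y
  rwa [map_one, one_smul, one_smul] at this

theorem dist_emb_smul {i : I} (a : G i) (x : F.X i) :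
    dist (emb i (a • x)) (of a • emb i x) = 0 := by
  rw [dist_emb_of_smul_emb, (F.hyp i).self]

theorem dist_origin_emb_base (i : I) : dist origin (emb i (F.base i)) = 0 := by
  have h := norm_of_smul_emb (1 : G i) (F.base i)
  rw [map_one, one_smul, one_smul, (F.hyp i).self] at h
  rw [dist_origin, h]

theorem dist_of_smul_of_ne {i : I} {a b : G i} (hab : a ≠ b) {p q : F.Point} (hp : p.Apart i)
    (hq : q.Apart i) : dist (of a • p) (of b • q) =
      F.d i (a • F.base i) (b • F.base i) + F.α i a p.norm + F.α i b q.norm := by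
  rw [dist, word_of_smul a hp, word_of_smul b hq, wordDist_rcons_of_ne]
  · rfl
  · exact fun h => hab (congrArg Prod.fst h)

theorem zeroHyperbolic : ZeroHyperbolic (dist : F.Point → F.Point → Λ) where
  self _ := F.letters.zeroHyperbolic.self _
  symm _ _ := F.letters.zeroHyperbolic.symm _ _
  four_point _ _ _ _ := F.letters.zeroHyperbolic.four_point _ _ _ _

theorem gromovTwice_mem (v p q : F.Point) : ∃ c : Λ, 2 • c = gromovTwice dist v p q :=
  F.letters.gromovTwice_mem v.word.toList p.word.toList q.word.toList

theorem pseudoGeodesic_emb {i : I} (x y : F.X i) : PseudoGeodesic dist (emb i x) (emb i y) := by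
  obtain ⟨σ, h0, h1, h2⟩ := (F.tree i).pseudoGeodesic x y
  refine ⟨fun s => emb i (σ s), ?_, ?_, ?_⟩
  · rw [dist_emb_emb, h0]
  · rw [dist_emb_emb, dist_emb_emb, h1]
  · rw [dist_emb_emb]
    intro s hs t ht
    rw [dist_emb_emb, h2 s hs t ht]

theorem pseudoGeodesic_emb_of_smul_emb {i : I} (x : F.X i) (a : G i) (y : F.X i) :
    PseudoGeodesic dist (emb i x) (of a • emb i y) :=
  (((pseudoGeodesic_emb x (a • y)).symm zeroHyperbolic).congr_left zeroHyperbolic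
    (dist_emb_smul a y)).symm zeroHyperbolic

theorem dist_of_smul_origin {i : I} (a : G i) :
    dist (of a • emb i (F.base i)) (of a • origin) = 0 := by
  rw [dist_smul, zeroHyperbolic.symm, dist_origin_emb_base, map_zero]

/-- Every path from `X i` to `of a • p` leaves `X i` at `a • F.base i`: the path inside `X i` up to
this point and the translate of a geodesic from the origin to `p` have lengths that add up. -/
theorem pseudoGeodesic_emb_of_smul {i : I} (x : F.X i) (a : G i) {p : F.Point} (hp : p.Apart i)
    (h : PseudoGeodesic dist origin p) : PseudoGeodesic dist (emb i x) (of a • p) := by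
  have h1 := pseudoGeodesic_emb_of_smul_emb x a (F.base i)
  have h2 := (h.map (f := fun p => of a • p) (dist_smul (of a))).congr_left zeroHyperbolic
    (by rw [zeroHyperbolic.symm]; exact dist_of_smul_origin a)
  refine h1.trans zeroHyperbolic h2 ?_
  rw [dist_emb_of_smul x a hp, dist_emb_of_smul_emb, zeroHyperbolic.congr_left
    (dist_of_smul_origin a), dist_smul, dist_origin, CoprodI.lift_of]

theorem pseudoGeodesic_origin (p : F.Point) : PseudoGeodesic dist origin p := by
  obtain ⟨g, o⟩ := p
  have hz := dist_origin_emb_base (F := F)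
  have hz' : ∀ i, dist (emb i (F.base i)) origin = 0 := fun i => by
    rw [zeroHyperbolic.symm, hz]
  induction g using reduced_induction with
  | one =>
    rcases o with _ | ⟨i, x⟩
    · refine ⟨fun _ => origin, zeroHyperbolic.self _, zeroHyperbolic.self _, ?_⟩
      change ∀ s ∈ Set.Icc 0 (dist origin origin), ∀ t ∈ Set.Icc 0 (dist origin origin), _
      rw [zeroHyperbolic.self]
      intro s hs t ht
      simp only [Set.mem_Icc] at hs ht
      rw [zeroHyperbolic.self]
      grind
    · exact (pseudoGeodesic_emb (F.base i) x).congr_left zeroHyperbolic (hz' i)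
  | mul i a g ha hg ih =>
    by_cases hcase : g = 1 ∧ o.map Sigma.fst = some i
    · obtain ⟨rfl, ho⟩ := hcase
      rcases o with _ | ⟨k, x⟩
      · simp at ho
      · obtain rfl : k = i := by simpa using ho
        exact (pseudoGeodesic_emb_of_smul_emb (F.base k) a x).congr_left zeroHyperbolic (hz' k)
    · have h1 : (⟨g, o⟩ : F.Point).Apart i :=
        apart_of_notStart hg fun h1 h2 => hcase ⟨h1, h2⟩
      exact (pseudoGeodesic_emb_of_smul (F.base i) a h1 ih).congr_left zeroHyperbolic (hz' i)

/-- Translation moves the first point into the wedge, where the form of the second point relative to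
the factor decides which of the geodesics above applies. -/
theorem pseudoGeodesic (p q : F.Point) : PseudoGeodesic dist p q := by
  obtain ⟨g, o⟩ := p
  have key : PseudoGeodesic dist ⟨1, o⟩ (g⁻¹ • q) := by
    rcases o with _ | ⟨i, x⟩
    · exact pseudoGeodesic_origin _
    · rcases exists_form i (g⁻¹ • q) with ⟨a, y, h⟩ | ⟨a, r, h, hr⟩
      · rw [h]
        exact pseudoGeodesic_emb_of_smul_emb x a y
      · rw [h]
        exact pseudoGeodesic_emb_of_smul x a hr (pseudoGeodesic_origin r)
  have := key.map (f := fun p => g • p) (dist_smul g)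
  rwa [smul_inv_smul, ← mk_eq_smul] at this

end Point

end PointedFamily

end LambdaTree

/-! ### Word length, cyclic reduction and elements of order two. -/

namespace LambdaTree

open Monoid (CoprodI)
open Monoid.CoprodI (of Word NeWord)

section WordLength

open scoped Classical

variable {I : Type uI} {G : I → Type uG} [∀ i, Group (G i)]

/-- The number of letters of the reduced word of `g`. -/
noncomputable def wordLen (g : CoprodI G) : ℕ := (Word.equiv g).toList.length

theorem wordLen_one : wordLen (1 : CoprodI G) = 0 := by
  rw [wordLen, equiv_one]
  rfl

theorem wordLen_of_mul_of_notStart {i : I} {a : G i} (ha : a ≠ 1) {g : CoprodI G}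
    (hg : NotStart i g) : wordLen (of a * g) = wordLen g + 1 := by
  rw [wordLen, equiv_of_mul_of_notStart ha hg]
  rfl

theorem wordLen_of_mul_le_of_notStart {i : I} (a : G i) {g : CoprodI G}
    (hg : NotStart i g) : wordLen g ≤ wordLen (of a * g) ∧ wordLen (of a * g) ≤ wordLen g + 1 := by
  by_cases ha : a = 1
  · subst ha
    simp
  · rw [wordLen_of_mul_of_notStart ha hg]
    simp

theorem wordLen_of_mul_le {i : I} (a : G i) (g : CoprodI G) :
    wordLen (of a * g) ≤ wordLen g + 1 := by
  obtain ⟨b, g, rfl, hg⟩ := exists_of_mul i g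
  rw [← mul_assoc, ← map_mul]
  have h1 := wordLen_of_mul_le_of_notStart (a * b) hg
  have h2 := wordLen_of_mul_le_of_notStart b hg
  omega

theorem wordLen_mul_le (g h : CoprodI G) : wordLen (g * h) ≤ wordLen g + wordLen h := by
  induction g using reduced_induction with
  | one => simp
  | mul i a g ha hg ih =>
    rw [mul_assoc, wordLen_of_mul_of_notStart ha hg]
    have := wordLen_of_mul_le a (g * h)
    omega

theorem wordLen_prod {i j : I} (w : NeWord G i j) : wordLen w.prod = w.toList.length := by
  have : Word.equiv w.prod = w.toWord := Word.equiv.apply_symm_apply _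
  rw [wordLen, this]
  rfl

theorem prod_ne_one {i j : I} (w : NeWord G i j) : w.prod ≠ 1 := by
  intro h
  have h1 := wordLen_prod w
  rw [h, wordLen_one] at h1
  exact w.toList_ne_nil (List.length_eq_zero_iff.1 h1.symm)

/-- The first and last factors differ, so copies of `w` concatenate without cancellation and the
lengths of its powers are unbounded. -/
theorem NeWord.exists_pow {i j : I} (w : NeWord G i j) (hij : i ≠ j) (k : ℕ) :
    ∃ w' : NeWord G i j, w'.prod = w.prod ^ (k + 1) ∧ k + 1 ≤ w'.toList.length := by
  have hpos : 1 ≤ w.toList.length := List.length_pos_iff.2 w.toList_ne_nil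
  induction k with
  | zero => exact ⟨w, by simp, hpos⟩
  | succ k ih =>
    obtain ⟨w', h1, h2⟩ := ih
    refine ⟨NeWord.append w' hij.symm w, ?_, ?_⟩
    · rw [NeWord.append_prod, h1, pow_succ _ (k + 1)]
    · simp only [NeWord.toList, List.length_append]
      omega

/-- Splits off the last syllable, which cyclic reduction moves to the front. -/
theorem NeWord.exists_prod_eq_mul_of {i j : I} (w : NeWord G i j) :
    (∃ b : G j, w.prod = of b) ∨ ∃ (l : I) (w' : NeWord G i l) (b : G j),
      w.prod = w'.prod * of b ∧ w'.toList.length + 1 ≤ w.toList.length := by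
  induction w with
  | singleton x h => exact Or.inl ⟨x, NeWord.prod_singleton x h⟩
  | append w₁ hne w₂ _ ih =>
    right
    rcases ih with ⟨b, hb⟩ | ⟨l, w', b, hb, hlen⟩
    · refine ⟨_, w₁, b, by rw [NeWord.append_prod, hb], ?_⟩
      have := List.length_pos_iff.2 w₂.toList_ne_nil
      simp only [NeWord.toList, List.length_append]
      omega
    · refine ⟨_, NeWord.append w₁ hne w', b, ?_, ?_⟩
      · rw [NeWord.append_prod, NeWord.append_prod, hb, mul_assoc]
      · simp only [NeWord.toList, List.length_append]
        omega

/-- Each element of a free product is trivial, conjugate into a factor, or conjugate to a cyclically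
reduced word of length at least two. -/
theorem exists_conj (g : CoprodI G) : g = 1 ∨ ∃ u : CoprodI G,
    (∃ (i : I) (a : G i), u * g * u⁻¹ = of a) ∨
      ∃ (i j : I) (w : NeWord G i j), i ≠ j ∧ u * g * u⁻¹ = w.prod := by
  induction hn : wordLen g using Nat.strong_induction_on generalizing g with
  | _ n ih =>
    by_cases hg : g = 1
    · exact Or.inl hg
    right
    have hne : Word.equiv g ≠ Word.empty := by
      intro h
      apply hg
      have := (Word.equiv.symm_apply_apply g).symm
      rw [h] at this
      exact this
    obtain ⟨i, j, w, hw⟩ := NeWord.of_word _ hne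
    obtain rfl : w.prod = g := by
      have := Word.equiv.symm_apply_apply g
      rw [← hw] at this
      exact this
    by_cases hij : i = j
    · subst hij
      rcases NeWord.exists_prod_eq_mul_of w with ⟨b, hb⟩ | ⟨l, w', b, hb, hlen⟩
      · exact ⟨1, Or.inl ⟨i, b, by simpa using hb⟩⟩
      -- First and last syllable lie in the same factor; conjugation by the last one merges it with
      -- the first and shortens the word.
      · obtain ⟨c, h, hc, hh⟩ := exists_of_mul i w'.prod
        have hconj : of b * w.prod * (of b)⁻¹ = of (b * c) * h := by
          rw [hb, hc, map_mul]
          group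
        have hc1 : c ≠ 1 := by
          rintro rfl
          rw [map_one, one_mul] at hc
          apply hh
          rw [← hc]
          have : Word.equiv w'.prod = w'.toWord := Word.equiv.apply_symm_apply _
          rw [this]
          change w'.toList.head?.map Sigma.fst = _
          rw [NeWord.toList_head?]
          rfl
        have hlt : wordLen (of (b * c) * h) < n := by
          have h1 := (wordLen_of_mul_le_of_notStart (b * c) hh).2
          have h2 := wordLen_of_mul_of_notStart hc1 hh
          rw [← hc, wordLen_prod] at h2
          rw [wordLen_prod] at hn
          omega
        rcases ih _ hlt _ rfl with h1 | ⟨u, hu⟩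
        · exact ⟨of b, Or.inl ⟨i, 1, by rw [hconj, h1, map_one]⟩⟩
        · have e : u * of b * w.prod * (u * of b)⁻¹ = u * (of (b * c) * h) * u⁻¹ := by
            rw [← hconj]
            group
          exact ⟨u * of b, by rw [e]; exact hu⟩
    · exact ⟨1, Or.inr ⟨i, j, w, hij, by simp⟩⟩

/-- A free product of groups without elements of order two has no elements of order two. -/
theorem eq_one_of_mul_self_eq_one (h2 : ∀ i (a : G i), a * a = 1 → a = 1) {g : CoprodI G}
    (hg : g * g = 1) : g = 1 := by
  rcases exists_conj g with h | ⟨u, ⟨i, a, ha⟩ | ⟨i, j, w, hij, hw⟩⟩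
  · exact h
  · have h1 : of (a * a) = (1 : CoprodI G) := by
      rw [map_mul, ← ha]
      calc u * g * u⁻¹ * (u * g * u⁻¹) = u * (g * g) * u⁻¹ := by group
        _ = 1 := by rw [hg]; group
    have h3 := h2 i a (CoprodI.of_injective i (by rw [h1, map_one]))
    rw [h3, map_one, conj_eq_one_iff] at ha
    exact ha
  · exfalso
    -- A cyclically reduced word followed by itself is again reduced, so its square is not trivial.
    apply prod_ne_one (NeWord.append w hij.symm w)
    rw [NeWord.append_prod, ← hw]
    calc u * g * u⁻¹ * (u * g * u⁻¹) = u * (g * g) * u⁻¹ := by group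
      _ = 1 := by rw [hg]; group

end WordLength

/-! ### Freeness. -/

namespace PointedFamily.Point

open scoped Classical

variable {I : Type uI} {G : I → Type uG} [∀ i, Group (G i)]
  {Λ : Type uL} [AddCommGroup Λ] [LinearOrder Λ] [IsOrderedAddMonoid Λ]
  {F : PointedFamily.{uI, uG, uL, uX} G Λ}

theorem d_pos {i : I} {x y : F.X i} (h : x ≠ y) : 0 < F.d i x y :=
  lt_of_le_of_ne ((F.hyp i).nonneg _ _) fun he => h (((F.tree i).eq_zero_iff _ _).1 he.symm)

section Free

variable (hfree : ∀ i (a : G i), a ≠ 1 → ∀ x : F.X i, a • x ≠ x)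
include hfree

theorem norm_pos {i : I} {a : G i} (ha : a ≠ 1) {p : F.Point} (hp : p.Apart i) :
    0 < (of a • p).norm := by
  rw [norm_of_smul a hp]
  exact add_pos_of_pos_of_nonneg (d_pos (hfree i a ha _).symm)
    (OrdAut.map_nonneg _ (norm_nonneg p))

/-- By translation the point may be taken in the wedge. For `x` in `X i`, split off the part `a` of
`g` in the `i`-th factor. If nothing remains, freeness on `X i` applies. Otherwise the distance
includes the rescaled norm of the remainder applied to `x`, which is positive because the first
syllable of the remainder moves its base point. The common base point is handled by the same
positivity. -/
theorem eq_one_of_dist_smul_eq_zero {g : CoprodI G} {p : F.Point} (hp : dist p (g • p) = 0) :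
    g = 1 := by
  obtain ⟨u, o⟩ := p
  have key : ∀ g : CoprodI G, dist (⟨1, o⟩ : F.Point) (g • ⟨1, o⟩) = 0 → g = 1 := by
    intro g hg
    rcases o with _ | ⟨i, x⟩
    · induction g using reduced_induction with
      | one => rfl
      | mul i a g ha hg' _ =>
        have h1 := norm_pos hfree ha (apart_of_notStart (F := F) hg' (o := none) (by simp))
        rw [← dist_origin, smul_mk] at h1
        rw [smul_mk, mul_one] at hg
        exact absurd hg h1.ne'
    · obtain ⟨a, g, rfl, hg'⟩ := exists_of_mul i g
      by_cases h1 : g = 1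
      · subst h1
        rw [mul_one] at *
        have h2 : dist (emb i x) (of a • emb i x) = 0 := hg
        rw [dist_emb_of_smul_emb, (F.tree i).eq_zero_iff] at h2
        by_contra ha
        refine hfree i a (fun ha' => ha ?_) x h2.symm
        rw [ha', map_one]
      · exfalso
        have h2 : (⟨g, some ⟨i, x⟩⟩ : F.Point).Apart i :=
          apart_of_notStart hg' fun h => absurd h h1
        have h3 : (of a * g) • (⟨1, some ⟨i, x⟩⟩ : F.Point) = of a • ⟨g, some ⟨i, x⟩⟩ := by
          rw [mul_smul, ← mk_eq_smul]
        have h4 := dist_emb_of_smul x a h2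
        rw [h3] at hg
        have h5 := (F.hyp i).nonneg x (a • F.base i)
        have h6 := OrdAut.map_nonneg (F.α i a) (norm_nonneg (⟨g, some ⟨i, x⟩⟩ : F.Point))
        have h7 : F.α i a (⟨g, some ⟨i, x⟩⟩ : F.Point).norm = 0 := by
          change dist (emb i x) _ = 0 at hg
          grind
        rw [OrdAut.map_eq_zero] at h7
        induction g using reduced_induction with
        | one => exact h1 rfl
        | mul j b g hb hg'' _ =>
          have hij : i ≠ j := by
            rintro rfl
            exact hg' (fstIdx_equiv_of_mul hb hg'')
          have h8 : (⟨g, some ⟨i, x⟩⟩ : F.Point).Apart j :=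
            apart_of_notStart hg'' fun _ => by simpa using hij
          exact (norm_pos hfree hb h8).ne' h7
  have h1 : u⁻¹ * g * u = 1 := by
    apply key
    rw [← OrdAut.map_eq_zero (CoprodI.lift F.α u), ← dist_smul, ← mul_smul, ← mk_eq_smul]
    have : u * (u⁻¹ * g * u) = g * u := by group
    rw [this, mul_smul, ← mk_eq_smul]
    exact hp
  rw [mul_assoc, inv_mul_eq_one] at h1
  exact mul_eq_right.1 h1.symm

end Free

end PointedFamily.Point

end LambdaTree

/-! ### Regularity. -/

namespace LambdaTree

open Monoid (CoprodI)
open Monoid.CoprodI (of Word NeWord)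

namespace PointedFamily.Point

open scoped Classical

variable {I : Type uI} {G : I → Type uG} [∀ i, Group (G i)]
  {Λ : Type uL} [AddCommGroup Λ] [LinearOrder Λ] [IsOrderedAddMonoid Λ]
  {F : PointedFamily.{uI, uG, uL, uX} G Λ}

theorem apart_smul_origin {i : I} {g : CoprodI G} (hg : NotStart i g) :
    (g • origin : F.Point).Apart i := by
  change (⟨g * 1, none⟩ : F.Point).Apart i
  rw [mul_one]
  exact apart_of_notStart hg (by simp)

/-- The length function based at the common base point of a free product is regular if those of the
factors are. -/
theorem isRegularLength (hreg : ∀ i, IsRegularLength (F.α i)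
    (fun a => F.d i (F.base i) (a • F.base i))) :
    IsRegularLength (CoprodI.lift F.α) (fun g => dist (origin : F.Point) (g • origin)) := by
  let L : CoprodI G → Λ := fun g => dist (origin : F.Point) (g • origin)
  let ℓ : ∀ i, G i → Λ := fun i a => F.d i (F.base i) (a • F.base i)
  have hL1 : L 1 = 0 := by
    change dist origin ((1 : CoprodI G) • origin) = 0
    rw [one_smul, zeroHyperbolic.self]
  have hLof : ∀ {i : I} (a : G i) {g : CoprodI G}, NotStart i g →
      L (of a * g) = ℓ i a + F.α i a (L g) := by
    intro i a g hg
    change dist origin ((of a * g) • origin) = _ + F.α i a (dist origin (g • origin))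
    rw [mul_smul, dist_origin, dist_origin, norm_of_smul a (apart_smul_origin hg)]
  have hLof1 : ∀ {i : I} (a : G i), L (of a) = ℓ i a := by
    intro i a
    rw [← mul_one (of a), hLof a (notStart_one i), hL1, map_zero, add_zero]
  have hLd : ∀ g h : CoprodI G, CoprodI.lift F.α g (L (g⁻¹ * h)) =
      dist (g • origin : F.Point) (h • origin) := by
    intro g h
    change CoprodI.lift F.α g (dist origin ((g⁻¹ * h) • origin)) = _
    rw [← dist_smul, ← mul_smul, mul_inv_cancel_left]
  -- The last clause is added for the induction: it lets a common first syllable be put in front of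
  -- `u` without cancellation.
  suffices H : ∀ g h : CoprodI G, ∃ u g' h' : CoprodI G, g = u * g' ∧ h = u * h' ∧
      2 • L u = L g + L h - dist (g • origin : F.Point) (h • origin) ∧
      L g = L u + CoprodI.lift F.α u (L g') ∧ L h = L u + CoprodI.lift F.α u (L h') ∧
      ∀ i, NotStart i g → NotStart i u by
    intro g h
    obtain ⟨u, g', h', h1, h2, h3, h4, h5, -⟩ := H g h
    refine ⟨u, g', h', h1, h2, ?_, h4, h5⟩
    change 2 • L u = L g + L h - CoprodI.lift F.α g (L (g⁻¹ * h))
    rw [hLd, h3]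
  intro g
  induction g using reduced_induction with
  | one =>
    intro h
    refine ⟨1, 1, h, (one_mul 1).symm, (one_mul h).symm, ?_, ?_, ?_, fun i hi => hi⟩
    · rw [hL1, one_smul, smul_zero, zero_add]
      exact (sub_self (L h)).symm
    · rw [hL1, map_zero, add_zero]
    · rw [hL1, map_one, OrdAut.one_apply, zero_add]
  | mul i a g ha hg ih =>
    intro h
    obtain ⟨b, h, rfl, hh⟩ := exists_of_mul i h
    have hji : ∀ j, NotStart j (of a * g) → j ≠ i := by
      rintro j hj rfl
      exact hj (fstIdx_equiv_of_mul ha hg)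
    by_cases hab : a = b
    · subst hab
      obtain ⟨u, g', h', rfl, rfl, h3, h4, h5, h6⟩ := ih h
      have hu := h6 i hg
      refine ⟨of a * u, g', h', (mul_assoc _ _ _).symm, (mul_assoc _ _ _).symm, ?_, ?_, ?_, ?_⟩
      · rw [hLof a hu, hLof a hg, hLof a hh, mul_smul (of a) (u * g'), mul_smul (of a) (u * h'),
          dist_smul, CoprodI.lift_of,
          smul_add, ← map_nsmul, h3, map_sub, map_add]
        abel
      · rw [hLof a hu, hLof a hg, h4, map_mul, OrdAut.mul_apply, CoprodI.lift_of, map_add,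
          add_assoc]
      · rw [hLof a hu, hLof a hh, h5, map_mul, OrdAut.mul_apply, CoprodI.lift_of, map_add,
          add_assoc]
      · exact fun j hj => notStart_of_mul (hji j hj) ha hu
    -- With different first syllables, where `b` may be `1`, the two paths part inside `X i`; the
    -- Gromov product is that of `a` and `b`, and the `u` supplied by the factor serves.
    · obtain ⟨u, a', b', rfl, rfl, h3, h4, h5⟩ := hreg i a b
      have h4' : ℓ i (u * a') = ℓ i u + F.α i u (ℓ i a') := h4
      have h5' : ℓ i (u * b') = ℓ i u + F.α i u (ℓ i b') := h5
      have h3' : 2 • ℓ i u = ℓ i (u * a') + ℓ i (u * b') -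
          F.d i ((u * a') • F.base i) ((u * b') • F.base i) := by
        rw [show 2 • ℓ i u = _ from h3]
        congr 1
        rw [← F.affine, ← mul_smul, mul_inv_cancel_left]
      refine ⟨of u, of a' * g, of b' * h, ?_, ?_, ?_, ?_, ?_, ?_⟩
      · rw [map_mul, mul_assoc]
      · rw [map_mul, mul_assoc]
      · rw [hLof1, hLof _ hg, hLof _ hh, h3', mul_smul (of (u * a')) g,
          mul_smul (of (u * b')) h,
          dist_of_smul_of_ne hab (apart_smul_origin hg) (apart_smul_origin hh), ← dist_origin,
          ← dist_origin]
        abel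
      · rw [hLof1, hLof _ hg, hLof _ hg, h4', CoprodI.lift_of, map_add, map_mul,
          OrdAut.mul_apply, add_assoc]
      · rw [hLof1, hLof _ hh, hLof _ hh, h5', CoprodI.lift_of, map_add, map_mul,
          OrdAut.mul_apply, add_assoc]
      · intro j hj
        by_cases hu : u = 1
        · rw [hu, map_one]
          exact notStart_one j
        · rw [← mul_one (of u)]
          exact notStart_of_mul (hji j hj) hu (notStart_one i)

end PointedFamily.Point

end LambdaTree

/-! ### Segments mapped into themselves, and rigidity. -/

namespace LambdaTree

open Monoid (CoprodI)
open Monoid.CoprodI (of Word NeWord)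

/-- `g` maps the segment from `p` to `q` into itself, preserving its direction. -/
def ShiftsSegment {Λ P G : Type*} [AddCommGroup Λ] [Group G] [MulAction G P] (D : P → P → Λ)
    (g : G) (p q : P) : Prop :=
  D p (g • p) + D (g • p) (g • q) + D (g • q) q = D p q

section Shifts

variable {Λ : Type uL} [AddCommGroup Λ] [LinearOrder Λ] [IsOrderedAddMonoid Λ]
  {P : Type*} {D : P → P → Λ} {G : Type*} [Group G] [MulAction G P] {α : G →* OrdAut Λ}

/-- Applying `g` to the order `p, k • p, k • q, q` and inserting the result between `g • p` and `g •
q` gives a chain from `p` to `q` whose lengths add up. -/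
theorem ShiftsSegment.mul (h : ZeroHyperbolic D) (haff : IsAffineAction D α) {g k : G} {p q : P}
    (hg : ShiftsSegment D g p q) (hk : ShiftsSegment D k p q) : ShiftsSegment D (g * k) p q := by
  have h1 := congrArg (α g) hk
  unfold ShiftsSegment at *
  rw [map_add, map_add, ← haff, ← haff, ← haff, ← haff, ← mul_smul, ← mul_smul] at h1
  have := h.triangle p (g • p) ((g * k) • p)
  have := h.triangle ((g * k) • q) (g • q) q
  have := h.triangle p ((g * k) • p) q
  have := h.triangle ((g * k) • p) ((g * k) • q) q
  grind

theorem ShiftsSegment.pow (h : ZeroHyperbolic D) (haff : IsAffineAction D α) {g : G} {p q : P}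
    (hg : ShiftsSegment D g p q) (n : ℕ) : ShiftsSegment D (g ^ n) p q := by
  induction n with
  | zero => simp [ShiftsSegment, h.self]
  | succ n ih =>
    rw [pow_succ]
    exact ih.mul h haff hg

theorem ShiftsSegment.symm (h : ZeroHyperbolic D) {g : G} {p q : P}
    (hg : ShiftsSegment D g p q) : ShiftsSegment D g q p := by
  unfold ShiftsSegment at *
  rw [h.symm q (g • q), h.symm (g • q) (g • p), h.symm (g • p) p, h.symm q p]
  grind

theorem ShiftsSegment.between (h : ZeroHyperbolic D) {g : G} {p q : P}
    (hg : ShiftsSegment D g p q) : D p (g • p) + D (g • p) q = D p q := by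
  unfold ShiftsSegment at *
  have := h.triangle (g • p) (g • q) q
  have := h.triangle p (g • p) q
  grind

theorem ShiftsSegment.orbit (h : ZeroHyperbolic D) (haff : IsAffineAction D α) {g : G} {p q : P}
    (hg : ShiftsSegment D g p q) :
    D p (g • p) + D (g • p) ((g * g) • p) = D p ((g * g) • p) := by
  have h1 := congrArg (α g) hg
  unfold ShiftsSegment at *
  rw [map_add, map_add, ← haff, ← haff, ← haff, ← haff, ← mul_smul, ← mul_smul] at h1
  have := h.triangle p (g • p) ((g * g) • p)
  have := h.triangle p ((g * g) • p) ((g * g) • q)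
  have := h.triangle p ((g * g) • q) (g • q)
  have := h.triangle p (g • q) q
  grind

theorem ShiftsSegment.smul_conj (haff : IsAffineAction D α) {g u : G} {p q : P}
    (hg : ShiftsSegment D g p q) : ShiftsSegment D (u * g * u⁻¹) (u • p) (u • q) := by
  have h1 : ∀ p : P, (u * g * u⁻¹) • u • p = u • g • p := fun p => by simp [mul_smul]
  unfold ShiftsSegment at *
  rw [h1, h1, haff u, haff u, haff u, haff u, ← map_add, ← map_add, hg]

/-- An element mapping a segment into itself shifts it, or its square does. -/
theorem shiftsSegment_or_mul_self (h : ZeroHyperbolic D) (haff : IsAffineAction D α) {g : G}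
    {p q : P} (hp : D p (g • p) + D (g • p) q = D p q) (hq : D p (g • q) + D (g • q) q = D p q) :
    ShiftsSegment D g p q ∨ ShiftsSegment D (g * g) p q := by
  rcases le_total (D p (g • p)) (D p (g • q)) with hle | hle
  · left
    have := h.dist_eq_sub hp hq hle
    unfold ShiftsSegment
    grind
  -- Here `g` reverses the direction of the segment, so its square preserves it.
  · right
    have h0 := h.dist_eq_sub hq hp hle
    have h1 : D p (g • q) + D (g • q) (g • p) + D (g • p) q = D p q := by grind
    have h2 := congrArg (α g) h1
    unfold ShiftsSegment
    rw [map_add, map_add, ← haff, ← haff, ← haff, ← haff, ← mul_smul, ← mul_smul] at h2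
    have := h.symm (g • p) (g • q)
    have := h.symm (g • p) ((g * g) • q)
    have := h.symm ((g * g) • p) ((g * g) • q)
    have := h.symm (g • q) ((g * g) • p)
    have := h.triangle p (g • q) ((g * g) • p)
    have := h.triangle ((g * g) • q) (g • p) q
    have := h.triangle p ((g * g) • p) q
    have := h.triangle ((g * g) • p) ((g * g) • q) q
    grind

/-- By rigidity the image is the whole segment, so `p` lies between `g • p` and `g • q`. With the
order `p, g • p, g • q, q` this leaves no room between `p` and `g • p`. -/
theorem ShiftsSegment.smul_eq_of_isRigidAction (hD : IsLambdaTree D) (haff : IsAffineAction D α)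
    (hr : IsRigidAction G D) {g : G} {p q : P} (hg : ShiftsSegment D g p q) : g • p = p := by
  have h := hD.zeroHyperbolic
  unfold ShiftsSegment at hg
  have hsub : (fun z => g • z) '' segment D p q ⊆ segment D p q := by
    rintro _ ⟨z, hz, rfl⟩
    change D p z + D z q = D p q at hz
    change D p (g • z) + D (g • z) q = D p q
    have h1 := congrArg (α g) hz
    rw [map_add, ← haff, ← haff, ← haff] at h1
    have := h.triangle p (g • p) (g • z)
    have := h.triangle (g • z) (g • q) q
    have := h.triangle p (g • z) q
    grind
  have hsup : segment D p q ⊆ (fun z => g • z) '' segment D p q := by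
    by_contra hn
    exact hr g p q ⟨hsub, hn⟩
  obtain ⟨z, hz, hzp⟩ := hsup (show p ∈ segment D p q by simp [segment, h.self])
  change D p z + D z q = D p q at hz
  have hzp' : g • z = p := hzp
  have h1 := congrArg (α g) hz
  rw [map_add, ← haff, ← haff, ← haff, hzp'] at h1
  have := h.triangle p (g • q) q
  have := h.symm p (g • p)
  have := h.nonneg p (g • p)
  rw [← hD.eq_zero_iff]
  grind

end Shifts

namespace PointedFamily.Point

open scoped Classical

variable {I : Type uI} {G : I → Type uG} [∀ i, Group (G i)]
  {Λ : Type uL} [AddCommGroup Λ] [LinearOrder Λ] [IsOrderedAddMonoid Λ]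
  {F : PointedFamily.{uI, uG, uL, uX} G Λ}

theorem word_mk_of_mul {i : I} {a : G i} (ha : a ≠ 1) {g : CoprodI G} (hg : NotStart i g)
    (o : Option (Σ i, F.X i)) :
    (∃ m : F.Mon i, g = 1 ∧ (⟨of a * g, o⟩ : F.Point).word.toList = [⟨i, m⟩]) ∨
      (⟨of a * g, o⟩ : F.Point).word.toList =
        (⟨i, (a, 1)⟩ : Σ i, F.Mon i) :: (⟨g, o⟩ : F.Point).word.toList := by
  have hne : ∀ x : PointedSet (F.X i) (F.base i), ((a, x) : F.Mon i) ≠ 1 := fun x h =>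
    ha (congrArg Prod.fst h)
  by_cases hcase : g = 1 ∧ o.map Sigma.fst = some i
  · obtain ⟨rfl, ho⟩ := hcase
    rcases o with _ | ⟨k, x⟩
    · simp at ho
    · obtain rfl : k = i := by simpa using ho
      refine Or.inl ⟨(a, x), rfl, ?_⟩
      change (of a • (emb k x : F.Point)).word.toList = _
      rw [word_of_smul_emb, Word.rcons, dif_neg (hne x)]
      rfl
  · right
    have h1 : (⟨g, o⟩ : F.Point).Apart i := apart_of_notStart hg fun h1 h2 => hcase ⟨h1, h2⟩
    change (of a • (⟨g, o⟩ : F.Point)).word.toList = _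
    rw [word_of_smul a h1, Word.rcons, dif_neg (hne 1)]
    rfl

/-- Every syllable of `g` survives as a letter; a point of the wedge is at most absorbed into the
last one. -/
theorem wordLen_le_length (g : CoprodI G) (o : Option (Σ i, F.X i)) :
    wordLen g ≤ (⟨g, o⟩ : F.Point).word.toList.length := by
  induction g using reduced_induction with
  | one => simp [wordLen_one]
  | mul i a g ha hg ih =>
    rw [wordLen_of_mul_of_notStart ha hg]
    rcases word_mk_of_mul ha hg o with ⟨m, rfl, h⟩ | h
    · rw [h, wordLen_one]
      rfl
    · rw [h, List.length_cons]
      omega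

/-- In a family of free actions, all letters of the word of a point except the last one have
positive length. -/
theorem isChain_word (hfree : ∀ i (a : G i), a ≠ 1 → ∀ x : F.X i, a • x ≠ x) (p : F.Point) :
    p.word.toList.IsChain fun a _ => 0 < F.letters.len a := by
  obtain ⟨g, o⟩ := p
  induction g using reduced_induction with
  | one =>
    have h1 : (⟨1, o⟩ : F.Point).word = start o := by
      change F.toMon 1 • start o = start o
      rw [map_one, one_smul]
    rw [h1]
    rcases o with _ | ⟨i, x⟩
    · exact List.isChain_nil
    · rw [start, Word.rcons]
      split_ifs
      · exact List.isChain_nil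
      · exact List.isChain_singleton _
  | mul i a g ha hg ih =>
    rcases word_mk_of_mul ha hg o with ⟨m, -, h⟩ | h
    · rw [h]
      exact List.isChain_singleton _
    · rw [h]
      refine ih.cons fun _ _ => ?_
      exact d_pos (hfree i a ha _).symm

/-- A point behind `b` times the base point which is moved along a segment by the square of
`a : G i` is at distance zero from `X i`. -/
theorem exists_dist_emb_eq_zero {i : I} {a : G i} (ha : a ≠ 1) (ha2 : a * a ≠ 1) {p : F.Point}
    (hp : dist p (of a • p) + dist (of a • p) ((of a * of a) • p) = dist p ((of a * of a) • p)) :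
    ∃ x : F.X i, dist p (emb i x) = 0 := by
  rcases exists_form i p with ⟨b, x, rfl⟩ | ⟨b, r, rfl, hr⟩
  · exact ⟨b • x, by rw [zeroHyperbolic.symm, dist_emb_smul]⟩
  · refine ⟨b • F.base i, ?_⟩
    have e1 : of a • of b • r = of (a * b) • r := by rw [map_mul, mul_smul]
    have e2 : (of a * of a) • of b • r = of (a * a * b) • r := by
      rw [map_mul, map_mul, mul_smul (of a * of a)]
    have n1 : b ≠ a * b := fun h => ha (mul_eq_right.1 h.symm)
    have n2 : b ≠ a * a * b := fun h => ha2 (mul_eq_right.1 h.symm)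
    have n3 : a * b ≠ a * a * b := fun h => ha (by
      rw [mul_assoc] at h
      exact mul_eq_right.1 h.symm)
    rw [e1, e2, dist_of_smul_of_ne n1 hr hr, dist_of_smul_of_ne n2 hr hr,
      dist_of_smul_of_ne n3 hr hr] at hp
    have h1 := (F.hyp i).triangle (b • F.base i) ((a * b) • F.base i) ((a * a * b) • F.base i)
    have h2 := OrdAut.map_nonneg (F.α i (a * b)) (norm_nonneg r)
    -- The detour from `X i` to the middle point is counted twice on the left of `hp` and not at all
    -- on the right.
    have h3 : F.α i (a * b) r.norm = 0 := by grind
    rw [OrdAut.map_eq_zero] at h3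
    rw [zeroHyperbolic.symm, dist_emb_of_smul _ _ hr, (F.hyp i).self, h3, map_zero, add_zero]

/-- In the tree of a free product of free rigid actions no nontrivial element shifts a segment. -/
theorem eq_one_of_shiftsSegment (hfree : ∀ i (a : G i), a ≠ 1 → ∀ x : F.X i, a • x ≠ x)
    (h2 : ∀ i (a : G i), a * a = 1 → a = 1) (hrigid : ∀ i, IsRigidAction (G i) (F.d i))
    {g : CoprodI G} {p q : F.Point} (hg : ShiftsSegment dist g p q) : g = 1 := by
  have hz := zeroHyperbolic (F := F)
  rcases exists_conj g with h | ⟨u, ⟨i, a, ha⟩ | ⟨i, j, w, hij, hw⟩⟩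
  · exact h
  · have hs := hg.smul_conj (u := u) isAffineAction
    rw [ha] at hs
    have ha1 : a = 1 := by
      by_contra hne
      have hne2 : a * a ≠ 1 := fun h => hne (h2 i a h)
      obtain ⟨x, hx⟩ := exists_dist_emb_eq_zero hne hne2 (hs.orbit hz isAffineAction)
      obtain ⟨y, hy⟩ := exists_dist_emb_eq_zero hne hne2 ((hs.symm hz).orbit hz isAffineAction)
      have hk : ∀ {r : F.Point} {z : F.X i}, dist r (emb i z) = 0 →
          dist (of a • r) (emb i (a • z)) = 0 := by
        intro r z hr
        rw [hz.symm, hz.congr_left (dist_emb_smul a z), dist_smul, hz.symm, hr, map_zero]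
      have hs' : ShiftsSegment (F.d i) a x y := by
        unfold ShiftsSegment at *
        rw [hz.congr_left hx, hz.congr_left hx, hz.congr_right hy, hz.congr_right hy,
          hz.congr_right (hk hx), hz.congr_left (hk hx), hz.congr_right (hk hy),
          hz.congr_left (hk hy)] at hs
        simpa only [dist_emb_emb] using hs
      exact hfree i a hne x (hs'.smul_eq_of_isRigidAction (F.tree i) (F.affine i) (hrigid i))
    rw [ha1, map_one, conj_eq_one_iff] at ha
    exact ha
  · exfalso
    -- All `g ^ k • p` lie on the segment from `p` to `q`, hence on a segment from the origin to `p`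
    -- or to `q`, which bounds their words independently of `k`.
    have hlen : ∀ k : ℕ, wordLen (g ^ k * p.elt) ≤
        max p.word.toList.length q.word.toList.length + 1 := by
      intro k
      have hb := (hg.pow hz isAffineAction k).between hz
      have h3 : wordLen (g ^ k * p.elt) ≤ (g ^ k • p).word.toList.length :=
        wordLen_le_length _ p.pt
      have key : ∀ r : F.Point, dist origin (g ^ k • p) + dist (g ^ k • p) r = dist origin r →
          (g ^ k • p).word.toList.length ≤ r.word.toList.length + 1 := by
        intro r hr
        rw [dist_origin, dist_origin] at hr
        exact F.letters.length_le_of_between _ _ (isChain_word hfree _) hr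
      rcases hz.between_of_between hb origin with h4 | h4
      · have := key p h4
        have := le_max_left p.word.toList.length q.word.toList.length
        omega
      · have := key q h4
        have := le_max_right p.word.toList.length q.word.toList.length
        omega
    -- The bound on `g ^ k * p.elt` plus the cost of undoing the translation by `p.elt` and the
    -- conjugation by `u`. The power `B + 1` of `w` would have length at most `B`, yet it has at
    -- least `B + 1` letters.
    let B := wordLen u + (max p.word.toList.length q.word.toList.length + 1) +
      wordLen (p.elt⁻¹ * u⁻¹)
    obtain ⟨w', h5, h6⟩ := NeWord.exists_pow w hij B
    have h7 : w'.prod = u * (g ^ (B + 1) * p.elt) * (p.elt⁻¹ * u⁻¹) := by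
      rw [h5, ← hw, conj_pow]
      group
    have h8 := wordLen_prod w'
    rw [h7] at h8
    have h9 := wordLen_mul_le (u * (g ^ (B + 1) * p.elt)) (p.elt⁻¹ * u⁻¹)
    have h10 := wordLen_mul_le u (g ^ (B + 1) * p.elt)
    have h11 := hlen (B + 1)
    omega

end PointedFamily.Point

/-! ### Assembly of the results. -/

/-- The tree of a free product of affine actions on `Λ`-trees. -/
theorem exists_coprodI_tree {I : Type uI} {G : I → Type uG} [∀ i, Group (G i)]
    {Λ : Type uL} [AddCommGroup Λ] [LinearOrder Λ] [IsOrderedAddMonoid Λ]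
    (X : I → Type uX) [∀ i, MulAction (G i) (X i)] (d : ∀ i, X i → X i → Λ)
    (α : ∀ i, G i →* OrdAut Λ) (htree : ∀ i, IsLambdaTree (d i))
    (haff : ∀ i, IsAffineAction (d i) (α i)) :
    ∃ (Y : Type (max uI uG uL uX)) (_ : MulAction (CoprodI G) Y)
      (D : Y → Y → Λ) (β : CoprodI G →* OrdAut Λ) (φ : ∀ i, X i → Y),
      IsLambdaTree D ∧ IsAffineAction D β ∧ (∀ i, β.comp of = α i) ∧
      (∀ i x y, D (φ i x) (φ i y) = d i x y) ∧
      (∀ i (g : G i) x, φ i (g • x) = (of g : CoprodI G) • φ i x) ∧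
      ((∀ i, IsFreeAction (G i) (X i)) → IsFreeAction (CoprodI G) Y) ∧
      ((∀ i, IsFreeAction (G i) (X i) ∧ IsRigidAction (G i) (d i)) →
        IsFreeAction (CoprodI G) Y ∧ IsRigidAction (CoprodI G) D) ∧
      ((∀ i, IsRegularAction (d i) (α i)) → IsRegularAction D β) := by
  -- Regularity refers to a base point, so the trees must be glued at points witnessing it; a factor
  -- that is not regular gets an arbitrary one.
  have hbase : ∃ base : ∀ i, X i, ∀ i, IsRegularAction (d i) (α i) →
      IsRegularLength (α i) (fun a => d i (base i) (a • base i)) := by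
    have h : ∀ i, ∃ x : X i, IsRegularAction (d i) (α i) →
        IsRegularLength (α i) (fun a => d i x (a • x)) := by
      intro i
      by_cases hr : IsRegularAction (d i) (α i)
      · obtain ⟨x, hx⟩ := hr
        exact ⟨x, fun _ => hx⟩
      · exact ⟨(htree i).nonempty.some, fun h => absurd h hr⟩
    exact ⟨fun i => (h i).choose, fun i => (h i).choose_spec⟩
  obtain ⟨base, hbase⟩ := hbase
  let F : PointedFamily.{uI, uG, uL, uX} G Λ :=
    { X := X, act := inferInstance, d := d, α := α, tree := htree, affine := haff, base := base }
  have hz := PointedFamily.Point.zeroHyperbolic (F := F)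
  obtain ⟨Y, act, D, π, hD, haffD, hsurj, hdist, hequiv⟩ :=
    hz.exists_tree (hP := ⟨PointedFamily.Point.origin⟩) PointedFamily.Point.gromovTwice_mem
      PointedFamily.Point.pseudoGeodesic PointedFamily.Point.isAffineAction
  have hfix : (∀ i, IsFreeAction (G i) (X i)) → ∀ (g : CoprodI G) (y : Y), g • y = y → g = 1 := by
    intro hfree g y hy
    obtain ⟨p, rfl⟩ := hsurj y
    apply PointedFamily.Point.eq_one_of_dist_smul_eq_zero (F := F) (fun i => (hfree i).1) (p := p)
    rw [← hdist, hequiv, hy]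
    exact (hD.eq_zero_iff _ _).2 rfl
  have hfreeY : (∀ i, IsFreeAction (G i) (X i)) → IsFreeAction (CoprodI G) Y := by
    intro hfree
    -- An element of order two would be an inversion: it fixes no point, while its square fixes all
    -- of them.
    have h2 : ∀ i (a : G i), a * a = 1 → a = 1 := by
      intro i a ha
      by_contra hne
      exact (hfree i).2 a ⟨(hfree i).1 a hne, base i, by rw [pow_two, ha, one_smul]⟩
    refine ⟨fun g hg y hy => hg (hfix hfree g y hy), ?_⟩
    rintro g ⟨hno, y, hy⟩
    have hg := hfix hfree _ y hy
    rw [pow_two] at hg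
    exact hno y (by rw [eq_one_of_mul_self_eq_one h2 hg, one_smul])
  refine ⟨Y, act, D, CoprodI.lift α, fun i x => π (.emb i x), hD, haffD, fun i => by simp, ?_, ?_,
    hfreeY, ?_, ?_⟩
  · intro i x y
    rw [hdist]
    exact PointedFamily.Point.dist_emb_emb (F := F) x y
  · intro i a x
    rw [← hequiv, ← hD.eq_zero_iff, hdist]
    exact PointedFamily.Point.dist_emb_smul (F := F) a x
  · intro h
    refine ⟨hfreeY fun i => (h i).1, ?_⟩
    have h2 : ∀ i (a : G i), a * a = 1 → a = 1 := by
      intro i a ha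
      by_contra hne
      exact (h i).1.2 a ⟨(h i).1.1 a hne, base i, by rw [pow_two, ha, one_smul]⟩
    have hshift : ∀ (g : CoprodI G) (p q : F.Point),
        ShiftsSegment PointedFamily.Point.dist g p q → g = 1 := fun g p q hs =>
      PointedFamily.Point.eq_one_of_shiftsSegment (fun i => (h i).1.1) h2 (fun i => (h i).2) hs
    intro g x y hss
    obtain ⟨p, rfl⟩ := hsurj x
    obtain ⟨q, rfl⟩ := hsurj y
    have hmem : ∀ z : F.Point, π z ∈ segment D (π p) (π q) → PointedFamily.Point.dist p (g • z) +
        PointedFamily.Point.dist (g • z) q = PointedFamily.Point.dist p q := by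
      intro z hzs
      have h1 := hss.1 ⟨π z, hzs, rfl⟩
      change D (π p) (g • π z) + D (g • π z) (π q) = D (π p) (π q) at h1
      rwa [← hequiv, hdist, hdist, hdist] at h1
    have hg1 : g = 1 := by
      have hself := hz.self
      rcases shiftsSegment_or_mul_self hz PointedFamily.Point.isAffineAction
        (hmem p (by simp [segment, hdist, hself])) (hmem q (by simp [segment, hdist, hself]))
        with h1 | h1
      · exact hshift g p q h1
      · exact eq_one_of_mul_self_eq_one h2 (hshift _ p q h1)
    subst hg1
    apply hss.2
    intro z hz'
    exact ⟨z, hz', one_smul _ z⟩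
  · intro h
    refine ⟨π .origin, ?_⟩
    have h1 := PointedFamily.Point.isRegularLength (F := F) fun i => hbase i (h i)
    have h2 : (fun g : CoprodI G => D (π .origin) (g • π .origin)) =
        fun g => PointedFamily.Point.dist (.origin : F.Point) (g • .origin) := by
      funext g
      rw [← hequiv, hdist]
    rw [h2]
    exact h1

theorem IsATFOver.coprodI {I : Type uI} {G : I → Type uG} [∀ i, Group (G i)]
    {Λ : Type uL} [AddCommGroup Λ] [LinearOrder Λ] [IsOrderedAddMonoid Λ]
    (h : ∀ i, IsATFOver.{uG, uL, uX} Λ (G i)) :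
    IsATFOver.{max uI uG, uL, max uI uG uL uX} Λ (CoprodI G) := by
  choose X act d α htree haff hfree using h
  obtain ⟨Y, actY, D, β, -, hD, haffD, -, -, -, hfreeY, -, -⟩ :=
    exists_coprodI_tree X d α htree haff
  exact ⟨Y, actY, D, β, hD, haffD, hfreeY hfree⟩

end LambdaTree

/-- Universe levels are kept independent; taking all of them equal gives closure of the class of
`ATF` groups of that universe under free products. -/
theorem mainTheorem2 (I : Type uI) (G : I → Type uG) [∀ i, Group (G i)] :
    -- affine actions of the factors on trees over a common `Λ` extend to the free product
    (∀ (Λ : Type uL) [AddCommGroup Λ] [LinearOrder Λ] [IsOrderedAddMonoid Λ]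
        (X : I → Type uX) [∀ i, MulAction (G i) (X i)]
        (d : ∀ i, X i → X i → Λ) (α : ∀ i, G i →* LambdaTree.OrdAut Λ),
        (∀ i, LambdaTree.IsLambdaTree (d i)) →
        (∀ i, LambdaTree.IsAffineAction (d i) (α i)) →
        ∃ (Y : Type (max uI uG uL uX)) (_ : MulAction (Monoid.CoprodI G) Y)
          (D : Y → Y → Λ) (β : Monoid.CoprodI G →* LambdaTree.OrdAut Λ)
          (φ : ∀ i, X i → Y),
          LambdaTree.IsLambdaTree D ∧
          LambdaTree.IsAffineAction D β ∧
          -- the action extends the given ones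
          (∀ i, β.comp Monoid.CoprodI.of = α i) ∧
          (∀ i x y, D (φ i x) (φ i y) = d i x y) ∧
          (∀ i (g : G i) x, φ i (g • x) = (Monoid.CoprodI.of g : Monoid.CoprodI G) • φ i x) ∧
          -- and inherits freeness, freeness together with rigidity, and regularity
          ((∀ i, LambdaTree.IsFreeAction (G i) (X i)) →
            LambdaTree.IsFreeAction (Monoid.CoprodI G) Y) ∧
          ((∀ i, LambdaTree.IsFreeAction (G i) (X i) ∧ LambdaTree.IsRigidAction (G i) (d i)) →
            LambdaTree.IsFreeAction (Monoid.CoprodI G) Y ∧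
              LambdaTree.IsRigidAction (Monoid.CoprodI G) D) ∧
          ((∀ i, LambdaTree.IsRegularAction (d i) (α i)) →
            LambdaTree.IsRegularAction D β)) ∧
    -- `ATF(ℝ)` groups are closed under free products
    ((∀ i, LambdaTree.IsATFOver.{uG, 0, uX} ℝ (G i)) →
      LambdaTree.IsATFOver.{max uI uG, 0, max uI uG uX} ℝ (Monoid.CoprodI G)) ∧
    -- `ATF` groups are closed under free products
    ((∀ i, LambdaTree.IsATF.{uG, uL, uX} (G i)) →
      LambdaTree.IsATF.{max uI uG, max uI uL, max uI uG uL uX} (Monoid.CoprodI G)) := by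
  refine ⟨?_, ?_, ?_⟩
  · intro Λ _ _ _ X _ d α htree haff
    exact LambdaTree.exists_coprodI_tree X d α htree haff
  · exact fun h => LambdaTree.IsATFOver.coprodI h
  · intro h
    obtain ⟨Λ, i1, i2, i3, hΛ⟩ := LambdaTree.exists_common_isATFOver G h
    exact ⟨Λ, i1, i2, i3, LambdaTree.IsATFOver.coprodI hΛ⟩
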